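/- Let $(\Omega,\mathcal F,\mathbb P)$ be a measure space, $\theta:\Omega\to\Omega$ an invertible bimeasurable $\mathbb P$-preserving map, and $X$ a separable (real or complex) Banach space. A \emph{measurable linear cocycle} over $\theta$ is a map $\Phi:\mathbb Z_+\times\Omega\to\mathcal L(X)$ with $\Phi(0,\omega)=\mathrm{Id}$, $\Phi(n+m,\omega)=\Phi(m,\theta^n\omega)\Phi(n,\omega)$ and $\omega\mapsto\Phi(n,\omega)x$ measurable for all $n\in\mathbb Z_+$, $x\in X$; its generator is $\omega\mapsto\Phi(1,\omega)$. A random variable $K:\Omega\to(0,\infty)$ is \emph{tempered} if $\lim_{n\to\pm\infty}\frac1n\ln K(\theta^n\omega)=0$ for $\mathbb P$-a.e. $\omega$. Let $\widetilde\Omega\subset\Omega$ satisfy $\theta^{-1}(\widetilde\Omega)=\widetilde\Omega$ and have full measure. The cocycle $\Phi$ has a \emph{tempered exponential dichotomy} on $\widetilde\Omega$ with projections $\Pi^s$, exponent $\alpha$ and bound $K$ if $\alpha:\Omega\to(0,\infty)$ is a $\theta$-invariant random variable, $K:\Omega\to(0,\infty)$ is a tempered random variable, $\Pi^s:\widetilde\Omega\to\mathcal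 L(X)$ is strongly measurable, and, with $\Pi^u:=\mathrm{Id}-\Pi^s$, for all $\omega\in\widetilde\Omega$ and $n\in\mathbb Z_+$: $\Pi^s(\omega)^2=\Pi^s(\omega)$; $\Pi^s(\theta^n\omega)\Phi(n,\omega)=\Phi(n,\omega)\Pi^s(\omega)$; $\Phi(n,\omega)$ restricts to an isomorphism from $\mathcal R(\Pi^u(\omega))$ onto $\mathcal R(\Pi^u(\theta^n\omega))$; and, with $\Phi(-n,\omega):=(\Phi(n,\theta^{-n}\omega)|_{\mathcal R(\Pi^u(\theta^{-n}\omega))})^{-1}$, the map $\omega\mapsto\Phi(-n,\omega)\Pi^u(\omega)$ is strongly measurable on $\widetilde\Omega$ and $$\|\Phi(n,\omega)\Pi^s(\omega)\|\le K(\omega)e^{-\alpha(\omega)n},\qquad \|\Phi(-n,\omega)\Pi^u(\omega)\|\le K(\omega)e^{-\alpha(\omega)n}.$$ Let $(\Xi,|\cdot|)$ be a normed space, and let $\Phi$ and $\Psi_\xi$ ($\xi\in\Xi$) be measurable linear cocycles over $\theta$ with generators $A$ and $B_\xi$. Assume that $\Phi$ has a tempered exponential dichotomy on $\widetilde\Omega$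 with exponent $\alpha$ and bound $K$, and that $$\|A(\omega)-B_\xi(\omega)\|\le\frac{\rho(\omega)}{K(\theta\omega)}\quad(\omega\in\widetilde\Omega,\ \xi\in\Xi),$$ where $\rho:\Omega\to(0,\infty)$ is a $\theta$-invariant random variable with $\rho(\omega)<\frac{1-e^{-\alpha(\omega)}}{1+e^{-\alpha(\omega)}}$ for all $\omega\in\Omega$. Then every $\Psi_\xi$ has a tempered exponential dichotomy on $\widetilde\Omega$, with some projections $\widetilde\Pi_\xi$, exponent $\widetilde\alpha$ and bound $\widetilde K=\kappa K$, where $\widetilde\alpha$ and $\kappa$ do not depend on $\xi$ and are given by $$\widetilde\alpha=-\ln\Bigl(\cosh\alpha-\sqrt{\cosh^2\alpha-1-2\rho\sinh\alpha}\Bigr),\qquad \kappa=\Bigl(1+\frac{\rho}{(1-\varrho)(1-e^{-\alpha})}\Bigr)\max\{D_1,D_2\},$$ $$\varrho=\frac{\rho(1+e^{-\alpha})}{1-e^{-\alpha}},\quad D_1=\Bigl(1-\frac{\rho e^{-\alpha}}{1-e^{-(\alpha+\widetilde\alpha)}}\Bigr)^{-1},\quad D_2=\Bigl(1-\frac{\rho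 e^{-\widetilde\beta}}{1-e^{-(\alpha+\widetilde\beta)}}\Bigr)^{-1},\quad \widetilde\beta=\widetilde\alpha+\ln(1+2\rho\sinh\alpha).$$ These projections can be chosen such that the following holds. If moreover $$\|B_{\xi_1}(\omega)-B_{\xi_2}(\omega)\|\le\frac{\upsilon(\omega)|\xi_1-\xi_2|^\sigma}{K(\theta\omega)}\quad(\omega\in\widetilde\Omega,\ \xi_1,\xi_2\in\Xi)$$ for a $\theta$-invariant random variable $\upsilon:\Omega\to(0,\infty)$ and a constant $\sigma\in(0,1]$, then for all $\omega\in\widetilde\Omega$ the map $\xi\mapsto\widetilde\Pi_\xi(\omega)$ is Hölder continuous with exponent $\sigma$; precisely, $$\|\widetilde\Pi_{\xi_1}(\omega)-\widetilde\Pi_{\xi_2}(\omega)\|\le\frac{\kappa(\omega)^2\upsilon(\omega)K(\omega)(1+e^{-2\widetilde\alpha(\omega)})}{1-e^{-2\widetilde\alpha(\omega)}}\,|\xi_1-\xi_2|^\sigma\quad(\xi_1,\xi_2\in\Xi).$$ Furthermore, under the same additional assumption, for any family $(\widetilde\Pi_\xi)_{\xi\in\Xi}$ of projections of tempered exponential dichotomies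 of the $\Psi_\xi$ on $\widetilde\Omega$ with exponent $\widetilde\alpha$ and bound $\widetilde K$, this estimate holds for $\mathbb P$-a.e. $\omega$ (for all $\xi_1,\xi_2$ simultaneously). -/

import Mathlib

open MeasureTheory Filter Topology

/-- The orbit map `θ^n ω` of an invertible transformation, `n ∈ ℤ`. -/
def shift {Ω : Type*} [MeasurableSpace Ω] (θ : Ω ≃ᵐ Ω) (n : ℤ) (ω : Ω) : Ω :=
  ((θ.toEquiv : Equiv.Perm Ω) ^ n) ω

/-- `Φ : ℤ₊ × Ω → 𝓛(X)` is a (strongly) measurable linear cocycle over `θ`.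
Its generator is `ω ↦ Φ 1 ω`. -/
structure IsMeasurableLinearCocycle {Ω 𝕜 X : Type*} [MeasurableSpace Ω] [RCLike 𝕜]
    [NormedAddCommGroup X] [NormedSpace 𝕜 X] [MeasurableSpace X]
    (θ : Ω ≃ᵐ Ω) (Φ : ℕ → Ω → X →L[𝕜] X) : Prop where
  zero : ∀ ω, Φ 0 ω = ContinuousLinearMap.id 𝕜 X
  add : ∀ n m ω, Φ (n + m) ω = (Φ m (shift θ n ω)).comp (Φ n ω)
  measurable : ∀ n x, Measurable fun ω => Φ n ω x

/-- A positive random variable. -/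
def IsPosRV {Ω : Type*} [MeasurableSpace Ω] (K : Ω → ℝ) : Prop :=
  Measurable K ∧ ∀ ω, 0 < K ω

/-- A positive `θ`-invariant random variable. -/
def IsInvariantPosRV {Ω : Type*} [MeasurableSpace Ω] (θ : Ω ≃ᵐ Ω) (K : Ω → ℝ) : Prop :=
  IsPosRV K ∧ ∀ ω, K (θ ω) = K ω

/-- `ln K(θ^n ω) / n → 0` as `n → ±∞`, at the point `ω`. -/
def IsTemperedAt {Ω : Type*} [MeasurableSpace Ω] (θ : Ω ≃ᵐ Ω) (K : Ω → ℝ) (ω : Ω) : Prop :=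
  Tendsto (fun n : ℤ => Real.log (K (shift θ n ω)) / (n : ℝ)) atTop (𝓝 0) ∧
  Tendsto (fun n : ℤ => Real.log (K (shift θ n ω)) / (n : ℝ)) atBot (𝓝 0)

/-- A tempered random variable `K : Ω → (0, ∞)`. -/
def IsTempered {Ω : Type*} [MeasurableSpace Ω] (P : Measure Ω) (θ : Ω ≃ᵐ Ω) (K : Ω → ℝ) : Prop :=
  IsPosRV K ∧ ∀ᵐ ω ∂P, IsTemperedAt θ K ω

/-- The complementary projection `Π^u = Id - Π^s`. -/
def unstableProj {Ω 𝕜 X : Type*} [RCLike 𝕜] [NormedAddCommGroup X] [NormedSpace 𝕜 X]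
    (Pis : Ω → X →L[𝕜] X) (ω : Ω) : X →L[𝕜] X :=
  ContinuousLinearMap.id 𝕜 X - Pis ω

/-- The range of `Π^u(ω)`. -/
def unstableRange {Ω 𝕜 X : Type*} [RCLike 𝕜] [NormedAddCommGroup X] [NormedSpace 𝕜 X]
    (Pis : Ω → X →L[𝕜] X) (ω : Ω) : Set X :=
  Set.range (unstableProj Pis ω)

/-- The vector `Φ(-n, ω) Π^u(ω) x` for `n ≥ 0`: the preimage of `Π^u(ω) x` under the restriction of
`Φ(n, θ^{-n} ω)` to the range of `Π^u(θ^{-n} ω)`. -/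
noncomputable def backward {Ω 𝕜 X : Type*} [MeasurableSpace Ω] [RCLike 𝕜]
    [NormedAddCommGroup X] [NormedSpace 𝕜 X] (θ : Ω ≃ᵐ Ω) (Φ : ℕ → Ω → X →L[𝕜] X)
    (Pis : Ω → X →L[𝕜] X) (n : ℕ) (ω : Ω) (x : X) : X :=
  Function.invFunOn (Φ n (shift θ (-(n : ℤ)) ω)) (unstableRange Pis (shift θ (-(n : ℤ)) ω))
    (unstableProj Pis ω x)

/-- `Φ` has a tempered exponential dichotomy on `Ωt` with projections `Pis`, exponent `α` and
bound `K`. Only the values of `Pis` on `Ωt` matter, and measurability on `Ωt` refers to the trace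
σ-algebra. A bijection between the ranges of `Π^u` given by a bounded operator is an isomorphism by
the open mapping theorem. As `backward` is linear in its last argument, the pointwise
bound in `bound_u` is the bound of the operator norm. -/
structure IsTemperedDichotomy {Ω 𝕜 X : Type*} [MeasurableSpace Ω] [RCLike 𝕜]
    [NormedAddCommGroup X] [NormedSpace 𝕜 X] [MeasurableSpace X]
    (P : Measure Ω) (θ : Ω ≃ᵐ Ω) (Φ : ℕ → Ω → X →L[𝕜] X) (Ωt : Set Ω)
    (Pis : Ω → X →L[𝕜] X) (α K : Ω → ℝ) : Prop where
  invariant : θ ⁻¹' Ωt = Ωt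
  full : ∀ᵐ ω ∂P, ω ∈ Ωt
  measurable : ∀ x, Measurable fun ω : Ωt => Pis ω x
  proj : ∀ ω ∈ Ωt, (Pis ω).comp (Pis ω) = Pis ω
  comm : ∀ ω ∈ Ωt, ∀ n : ℕ, (Pis (shift θ n ω)).comp (Φ n ω) = (Φ n ω).comp (Pis ω)
  iso : ∀ ω ∈ Ωt, ∀ n : ℕ,
    Set.BijOn (Φ n ω) (unstableRange Pis ω) (unstableRange Pis (shift θ n ω))
  measurable_u : ∀ (n : ℕ) (x : X), Measurable fun ω : Ωt => backward θ Φ Pis n ω x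
  exponent : IsInvariantPosRV θ α
  tempered : IsTempered P θ K
  bound_s : ∀ ω ∈ Ωt, ∀ n : ℕ, ‖(Φ n ω).comp (Pis ω)‖ ≤ K ω * Real.exp (-α ω * n)
  bound_u : ∀ ω ∈ Ωt, ∀ (n : ℕ) (x : X),
    ‖backward θ Φ Pis n ω x‖ ≤ K ω * Real.exp (-α ω * n) * ‖x‖

/-- The exponent `α̃` as a function of `a = α(ω)` and `r = ρ(ω)`. -/
noncomputable def roughExponent (a r : ℝ) : ℝ :=
  -Real.log (Real.cosh a - √(Real.cosh a ^ 2 - 1 - 2 * r * Real.sinh a))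

/-- The auxiliary exponent `β̃ = α̃ + ln (1 + 2 ρ sinh α)`. -/
noncomputable def roughBeta (a r : ℝ) : ℝ :=
  roughExponent a r + Real.log (1 + 2 * r * Real.sinh a)

/-- The factor `κ`, for which the new bound is `K̃ = κ K`. -/
noncomputable def roughFactor (a r : ℝ) : ℝ :=
  (1 + r / ((1 - r * (1 + Real.exp (-a)) / (1 - Real.exp (-a))) * (1 - Real.exp (-a)))) *
    max (1 / (1 - r * Real.exp (-a) / (1 - Real.exp (-(a + roughExponent a r)))))
      (1 / (1 - r * Real.exp (-roughBeta a r) / (1 - Real.exp (-(a + roughBeta a r)))))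

/-- The Hölder estimate for a family of projections at the point `ω`, with exponent `σ` and constant
`κ² υ K (1 + e^{-2α̃}) / (1 - e^{-2α̃})`; here `a, r, k, u` are the values
of `α, ρ, K, υ` at `ω`. -/
def HolderEstimateAt {Ω 𝕜 X Ξ : Type*} [RCLike 𝕜] [NormedAddCommGroup X] [NormedSpace 𝕜 X]
    [NormedAddCommGroup Ξ] (Pis : Ξ → Ω → X →L[𝕜] X) (a r k u σ : ℝ) (ω : Ω) : Prop :=
  ∀ ξ₁ ξ₂ : Ξ, ‖Pis ξ₁ ω - Pis ξ₂ ω‖ ≤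
    roughFactor a r ^ 2 * u * k * (1 + Real.exp (-2 * roughExponent a r)) /
      (1 - Real.exp (-2 * roughExponent a r)) * ‖ξ₁ - ξ₂‖ ^ σ

/-! Along an orbit, a dichotomy is the same thing as an exponentially decaying Green kernel: for `m
≤ n`, `G n m` is the cocycle from time `m` to time `n` after Π^s, and for `n < m` it is minus the
inverse cocycle along the unstable spaces after Π^u. The identities in `IsGreen` capture this
without mentioning inverses, and the projections are the diagonal values.

The kernel W of a perturbed equation is sought as the solution of W n k = G n k + ∑ m, G n (m + 1)
(B m - A m) W m k. The perturbation is measured against 1 / K(θω), which cancels the factor K in the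
bound of G, so this linear operator has norm at most ϱ = ρ(1 + e^{-α})/(1 - e^{-α}) < 1 on bounded
sequences, however K grows along the orbit. The Neumann series gives W (`perturbed_eq`), and
uniqueness of bounded solutions (`eq_of_solutions`) yields the identities of a Green kernel for B.

For the decay, the norms of W on either side of the diagonal satisfy a scalar convolution
inequality, and `le_mul_pow_of_subsolution` compares them with an exact geometric solution. The two
ratios are roots of quadratic equations; `rough_spec` identifies them with e^{-α̃} and e^{-β̃}, and
the amplitudes with the two terms of κ.

For two perturbations B and B', the resolvent identity expresses the difference of the kernels by a
series in W (B' - B) W', where K cancels once more; this gives the Hölder estimate at every point.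
Finally, a dichotomy with tempered bound determines its projections (`proj_unique`), so the estimate
passes to any other choice almost everywhere. -/

/-! ### Algebra of Green kernels -/

/-- `G` is a Green kernel of the difference equation `x (n + 1) = A n * x n`. -/
structure IsGreen {R : Type*} [Ring R] (A : ℤ → R) (G : ℤ → ℤ → R) : Prop where
  forward : ∀ n m, G (n + 1) m = A n * G n m + if n + 1 = m then 1 else 0
  backward : ∀ n m, G n m = G n (m + 1) * A m + if n = m then 1 else 0
  proj : ∀ n m, G n m * G m m = if m ≤ n then G n m else 0

namespace IsGreen

variable {R : Type*} [Ring R] {A : ℤ → R} {G : ℤ → ℤ → R}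

lemma mul_of_le_of_le (h : IsGreen A G) {n k j : ℤ} (hn : k ≤ n) (hj : j ≤ k) :
    G n k * G k j = G n j := by
  induction j, hj using Int.leInductionDown with
  | base => simpa [hn] using h.proj n k
  | pred j hj ih =>
    have h1 := h.backward k (j - 1)
    have h2 := h.backward n (j - 1)
    rw [if_neg (by omega), sub_add_cancel, add_zero] at h1 h2
    rw [h1, h2, ← mul_assoc, ih]

lemma mul_of_lt_of_le (h : IsGreen A G) {n k j : ℤ} (hn : n < k) (hj : j ≤ k) :
    G n k * G k j = 0 := by
  induction j, hj using Int.leInductionDown with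
  | base => simpa [not_le.2 hn] using h.proj n k
  | pred j hj ih =>
    have h1 := h.backward k (j - 1)
    rw [if_neg (by omega), sub_add_cancel, add_zero] at h1
    rw [h1, ← mul_assoc, ih, zero_mul]

/-- Expand `G (j + 1) (j + 1)` by the forward identity in `G k (j + 1) * G (j + 1) (j + 1) = 0`, and
absorb `A j` into the left factor by the backward identity. -/
lemma eq_neg_mul (h : IsGreen A G) {k j : ℤ} (hj : k < j) :
    G k (j + 1) = -(G k j * G j (j + 1)) := by
  have h1 := h.proj k (j + 1)
  have h2 := h.forward j (j + 1)
  have h3 := h.backward k j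
  rw [if_neg (by omega)] at h1
  rw [if_pos rfl] at h2
  rw [if_neg (by omega), add_zero] at h3
  rw [h2, mul_add, mul_one, ← mul_assoc, ← h3] at h1
  exact eq_neg_of_add_eq_zero_right h1

lemma diag_mul_of_lt (h : IsGreen A G) {k j : ℤ} (hj : k < j) : G k k * G k j = 0 := by
  replace hj : k + 1 ≤ j := hj
  induction j, hj using Int.leInduction with
  | base =>
    have h1 := h.proj k (k + 1)
    have h2 := h.forward k (k + 1)
    have h3 := h.backward k k
    rw [if_neg (by omega)] at h1
    rw [if_pos rfl] at h2
    rw [if_pos rfl] at h3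
    rw [h2, mul_add, mul_one, ← mul_assoc] at h1
    rw [h3, add_mul, one_mul, h1]
  | succ j hj ih => rw [h.eq_neg_mul (by omega), mul_neg, ← mul_assoc, ih, zero_mul, neg_zero]

lemma mul_of_le_of_lt (h : IsGreen A G) {n k j : ℤ} (hn : k ≤ n) (hj : k < j) :
    G n k * G k j = 0 := by
  rw [← h.mul_of_le_of_le hn le_rfl, mul_assoc, h.diag_mul_of_lt hj, mul_zero]

/-- The last of the four product rules, one for each position of `n` and `j` relative to `k`. The
minus sign comes from the sign of the unstable part. The rules are what makes `perturbed_proj` work.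
-/
lemma mul_of_lt_of_lt (h : IsGreen A G) {n k j : ℤ} (hn : n < k) (hj : k < j) :
    G n k * G k j = -G n j := by
  replace hj : k + 1 ≤ j := hj
  induction j, hj using Int.leInduction with
  | base => rw [h.eq_neg_mul hn, neg_neg]
  | succ j hj ih =>
    rw [h.eq_neg_mul (show k < j by omega), h.eq_neg_mul (show n < j by omega), mul_neg,
      ← mul_assoc, ih, neg_mul]

end IsGreen

/-! ### Comparison principle and geometric sums -/

/-- A bounded subsolution of a linear equation whose kernel has norm below one is nonpositive. -/
lemma nonpos_of_subsolution {ι : Type*} {h : ι → ι → ℝ} {c : ℝ} (h0 : ∀ n m, 0 ≤ h n m)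
    (hc0 : 0 ≤ c) (hc : c < 1) (hs : ∀ n, Summable (h n)) (hsc : ∀ n, ∑' m, h n m ≤ c)
    {d : ι → ℝ} {M : ℝ} (hd : ∀ n, d n ≤ M)
    (hsub : ∀ n, ∃ s, HasSum (fun m => h n m * d m) s ∧ d n ≤ s) (n : ι) : d n ≤ 0 := by
  -- Each application of the inequality improves the upper bound by the factor `c`. The maximum with
  -- 0 keeps the bound nonnegative, so that row sums may be replaced by `c`.
  have key : ∀ (j : ℕ) (n : ι), d n ≤ c ^ j * max M 0 := by
    intro j
    induction j with
    | zero => intro n; simpa using Or.inl (hd n)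
    | succ j ih =>
      intro n
      obtain ⟨s, hs', hds⟩ := hsub n
      have h1 : HasSum (fun m => h n m * (c ^ j * max M 0)) ((∑' m, h n m) * (c ^ j * max M 0)) :=
        (hs n).hasSum.mul_right _
      have h2 := hasSum_le (fun m => mul_le_mul_of_nonneg_left (ih m) (h0 n m)) hs' h1
      have h3 : (∑' m, h n m) * (c ^ j * max M 0) ≤ c * (c ^ j * max M 0) :=
        mul_le_mul_of_nonneg_right (hsc n) (by positivity)
      calc d n ≤ c * (c ^ j * max M 0) := hds.trans (h2.trans h3)
        _ = c ^ (j + 1) * max M 0 := by ring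
  have hlim : Tendsto (fun j : ℕ => c ^ j * max M 0) atTop (𝓝 (0 * max M 0)) :=
    (tendsto_pow_atTop_nhds_zero_of_lt_one hc0 hc).mul_const _
  rw [zero_mul] at hlim
  exact ge_of_tendsto' hlim (fun j => key j n)

/-- Interchange of the two summations in a kernel applied to a series. -/
lemma tsum_mul_tsum_comm {R ι κ : Type*} [NormedRing R] [CompleteSpace R]
    {H : ι → R} {y : κ → ι → R} {h : ι → ℝ} {b : κ → ℝ} (hh : Summable h) (hb : Summable b)
    (hH : ∀ l, ‖H l‖ ≤ h l) (hy : ∀ j l, ‖y j l‖ ≤ b j) :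
    ∑' l, H l * ∑' j, y j l = ∑' j, ∑' l, H l * y j l := by
  have hh0 : ∀ l, 0 ≤ h l := fun l => (norm_nonneg _).trans (hH l)
  have hys : ∀ l, Summable fun j => y j l := fun l => Summable.of_norm_bounded hb (fun j => hy j l)
  have hprod : Summable (Function.uncurry fun l j => H l * y j l) := by
    -- Nonnegativity of `b` is read off from `y` at some index `l`, which an empty index set does
    -- not provide.
    by_cases hι : IsEmpty ι
    · exact summable_empty
    · obtain ⟨l₀⟩ := not_isEmpty_iff.1 hι
      have hb0 : ∀ j, 0 ≤ b j := fun j => (norm_nonneg _).trans (hy j l₀)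
      refine Summable.of_norm_bounded (hh.mul_of_nonneg hb hh0 hb0) ?_
      rintro ⟨l, j⟩
      exact (norm_mul_le _ _).trans
        (mul_le_mul (hH l) (hy j l) (norm_nonneg _) (hh0 l))
  refine (tsum_congr fun l => ((hys l).tsum_mul_left _).symm).trans ?_
  exact hprod.tsum_comm.symm

lemma HasSum.congr_of_eq {ι : Type*} {f g : ι → ℝ} {a b : ℝ} (hf : HasSum f a)
    (hg : ∀ i, g i = f i) (hb : b = a) : HasSum g b := by
  rwa [funext hg, hb]

lemma hasSum_pow_natAbs {q : ℝ} (hq0 : 0 ≤ q) (hq1 : q < 1) :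
    HasSum (fun m : ℤ => q ^ m.natAbs) ((1 + q) / (1 - q)) := by
  have h0 := hasSum_geometric_of_lt_one hq0 hq1
  have h1 : HasSum (fun n : ℕ => q ^ (n : ℤ).natAbs) (1 - q)⁻¹ :=
    h0.congr_of_eq (fun n => by rw [Int.natAbs_natCast]) rfl
  have h2 : HasSum (fun n : ℕ => q ^ (-((n : ℤ) + 1)).natAbs) (q * (1 - q)⁻¹) := by
    refine HasSum.congr_of_eq (h0.mul_left q) (fun n => ?_) rfl
    rw [show (-((n : ℤ) + 1)).natAbs = n + 1 by omega, pow_succ']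
  have h3 : HasSum (fun m : ℤ => q ^ m.natAbs) ((1 - q)⁻¹ + q * (1 - q)⁻¹) :=
    HasSum.of_nat_of_neg_add_one (f := fun m : ℤ => q ^ m.natAbs) h1 h2
  exact h3.congr_of_eq (fun _ => rfl) (by rw [div_eq_mul_inv, add_mul, one_mul])

lemma hasSum_pow_natAbs_sub {q : ℝ} (hq0 : 0 ≤ q) (hq1 : q < 1) (n : ℤ) :
    HasSum (fun m : ℤ => q ^ (n - (m + 1)).natAbs) ((1 + q) / (1 - q)) := by
  have h := ((Equiv.subLeft (n - 1)).hasSum_iff).2 (hasSum_pow_natAbs hq0 hq1)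
  refine h.congr_of_eq (fun m => ?_) rfl
  rw [Function.comp_apply, Equiv.subLeft_apply, sub_sub, add_comm]

/-- Splitting off the term `i = 0` and shifting the index reduces `j + 1` to `j`. The value is a
combination of `l ^ j` and `q ^ j`; in the comparison argument the part with `q ^ j` balances the
inhomogeneous term. -/
lemma hasSum_pow_natAbs_mul_pow {q l : ℝ} (hq0 : 0 ≤ q) (hq1 : q < 1) (hl0 : 0 ≤ l) (hl1 : l < 1)
    (hne : q ≠ l) (j : ℕ) :
    HasSum (fun i : ℕ => q ^ ((j : ℤ) - (i + 1)).natAbs * l ^ i)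
      ((l ^ j - q ^ j) / (l - q) + l ^ j * (q / (1 - q * l))) := by
  have hql : q * l < 1 := by nlinarith
  have hlq : l - q ≠ 0 := sub_ne_zero.2 hne.symm
  induction j with
  | zero =>
    have := (hasSum_geometric_of_lt_one (mul_nonneg hq0 hl0) hql).mul_left q
    refine HasSum.congr_of_eq this (fun i => ?_) ?_
    · rw [show (((0 : ℕ) : ℤ) - ((i : ℤ) + 1)).natAbs = i + 1 by omega, mul_pow]; ring
    · rw [pow_zero, pow_zero, sub_self, zero_div, zero_add, one_mul, div_eq_mul_inv]
  | succ j ih =>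
    rw [← hasSum_nat_add_iff' 1]
    refine HasSum.congr_of_eq (ih.mul_left l) (fun i => ?_) ?_
    · rw [show (((j + 1 : ℕ) : ℤ) - (((i + 1 : ℕ) : ℤ) + 1)).natAbs
        = ((j : ℤ) - ((i : ℤ) + 1)).natAbs by omega]
      ring
    · rw [Finset.sum_range_one,
        show (((j + 1 : ℕ) : ℤ) - (((0 : ℕ) : ℤ) + 1)).natAbs = j by omega]
      generalize q / (1 - q * l) = t
      field_simp
      ring

/-! ### Neumann series for the perturbed kernel -/

/-- The terms of the Neumann series for the Green kernel of a perturbed equation. -/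
noncomputable def perturbIter {R : Type*} [NormedRing R] (G : ℤ → ℤ → R) (C : ℤ → R) (k : ℤ) :
    ℕ → ℤ → R
  | 0 => fun n => G n k
  | j + 1 => fun n => ∑' m, G n (m + 1) * C m * perturbIter G C k j m

/-- The Green kernel of the equation perturbed by `C`, as a Neumann series. -/
noncomputable def perturbedKernel {R : Type*} [NormedRing R] (G : ℤ → ℤ → R) (C : ℤ → R)
    (n k : ℤ) : R :=
  ∑' j, perturbIter G C k j n

/-- The construction commutes with time translation, so the kernel over the orbit of a shifted point
can be read off from the kernel over the original orbit. -/
lemma perturbIter_shift {R : Type*} [NormedRing R] {G G' : ℤ → ℤ → R} {C C' : ℤ → R} {k : ℤ}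
    (hG : ∀ n m, G' n m = G (n + k) (m + k)) (hC : ∀ m, C' m = C (m + k)) (l : ℤ) (j : ℕ) (n : ℤ) :
    perturbIter G' C' l j n = perturbIter G C (l + k) j (n + k) := by
  induction j generalizing n with
  | zero => exact hG n l
  | succ j ih =>
    simp only [perturbIter]
    rw [← (Equiv.addRight k).tsum_eq fun m => G (n + k) (m + 1) * C m * perturbIter G C (l + k) j m]
    refine tsum_congr fun m => ?_
    rw [ih, hG, hC, Equiv.coe_addRight, add_right_comm m 1 k]

lemma perturbedKernel_shift {R : Type*} [NormedRing R] {G G' : ℤ → ℤ → R} {C C' : ℤ → R} {k : ℤ}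
    (hG : ∀ n m, G' n m = G (n + k) (m + k)) (hC : ∀ m, C' m = C (m + k)) (n l : ℤ) :
    perturbedKernel G' C' n l = perturbedKernel G C (n + k) (l + k) :=
  tsum_congr fun j => perturbIter_shift hG hC l j n

/-- The equation with coefficients `B` is a small perturbation of the equation with coefficients `A`
and Green kernel `G`, which is bounded by `K m * q ^ |n - m|`. -/
structure IsGreenPerturbation {R : Type*} [NormedRing R] (A B : ℤ → R) (G : ℤ → ℤ → R) (K : ℤ → ℝ)
    (q r : ℝ) : Prop where
  green : IsGreen A G
  K_pos : ∀ n, 0 < K n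
  q_pos : 0 < q
  q_lt : q < 1
  r_pos : 0 < r
  r_lt : r < (1 - q) / (1 + q)
  bound : ∀ n m, ‖G n m‖ ≤ K m * q ^ (n - m).natAbs
  bound_diag : ∀ n, ‖1 - G n n‖ ≤ K n
  close : ∀ m, ‖B m - A m‖ ≤ r / K (m + 1)

namespace IsGreenPerturbation

variable {R : Type*} [NormedRing R] {A B : ℤ → R} {G : ℤ → ℤ → R} {K : ℤ → ℝ} {q r : ℝ}

/-- The weight `K (m + 1)` of `G n (m + 1)` is exactly the one divided out in `close`; after
cancellation the bound depends on the time difference only. -/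
lemma norm_kernel_le (h : IsGreenPerturbation A B G K q r) (n m : ℤ) :
    ‖G n (m + 1) * (B m - A m)‖ ≤ r * q ^ (n - (m + 1)).natAbs := by
  have hK := h.K_pos (m + 1)
  have hq := h.q_pos
  calc ‖G n (m + 1) * (B m - A m)‖ ≤ ‖G n (m + 1)‖ * ‖B m - A m‖ := norm_mul_le _ _
    _ ≤ (K (m + 1) * q ^ (n - (m + 1)).natAbs) * (r / K (m + 1)) :=
      mul_le_mul (h.bound _ _) (h.close m) (norm_nonneg _) (by positivity)
    _ = r * q ^ (n - (m + 1)).natAbs := by field_simp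

lemma hasSum_weight (h : IsGreenPerturbation A B G K q r) (n : ℤ) :
    HasSum (fun m : ℤ => r * q ^ (n - (m + 1)).natAbs) (r * (1 + q) / (1 - q)) := by
  refine HasSum.congr_of_eq ((hasSum_pow_natAbs_sub h.q_pos.le h.q_lt n).mul_left r)
    (fun _ => rfl) (mul_div_assoc _ _ _)

lemma contraction_nonneg (h : IsGreenPerturbation A B G K q r) : 0 ≤ r * (1 + q) / (1 - q) :=
  div_nonneg (mul_nonneg h.r_pos.le (by linarith [h.q_pos])) (by linarith [h.q_lt])

lemma contraction_lt_one (h : IsGreenPerturbation A B G K q r) : r * (1 + q) / (1 - q) < 1 := by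
  have h1 := h.q_pos
  have h2 := h.q_lt
  rw [div_lt_one (by linarith)]
  exact (lt_div_iff₀ (by linarith)).1 h.r_lt

lemma norm_kernel_mul_le (h : IsGreenPerturbation A B G K q r) {y : R} {M : ℝ} (hy : ‖y‖ ≤ M)
    (n m : ℤ) :
    ‖G n (m + 1) * (B m - A m) * y‖ ≤ r * q ^ (n - (m + 1)).natAbs * M :=
  (norm_mul_le _ _).trans (mul_le_mul (h.norm_kernel_le n m) hy (norm_nonneg _)
    (mul_nonneg h.r_pos.le (pow_nonneg h.q_pos.le _)))

lemma norm_tsum_le (h : IsGreenPerturbation A B G K q r) {y : ℤ → R} {M : ℝ} (hy : ∀ m, ‖y m‖ ≤ M)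
    (n : ℤ) :
    ‖∑' m, G n (m + 1) * (B m - A m) * y m‖ ≤ r * (1 + q) / (1 - q) * M :=
  tsum_of_norm_bounded ((h.hasSum_weight n).mul_right M) fun m => h.norm_kernel_mul_le (hy m) n m

lemma norm_iter_le (h : IsGreenPerturbation A B G K q r) (k : ℤ) (j : ℕ) (n : ℤ) :
    ‖perturbIter G (fun m => B m - A m) k j n‖ ≤ (r * (1 + q) / (1 - q)) ^ j * K k := by
  induction j generalizing n with
  | zero =>
    refine (h.bound n k).trans ?_
    rw [pow_zero, one_mul]
    exact mul_le_of_le_one_right (h.K_pos k).le (pow_le_one₀ h.q_pos.le h.q_lt.le)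
  | succ j ih =>
    rw [pow_succ', mul_assoc]
    exact h.norm_tsum_le ih n

lemma hasSum_majorant (h : IsGreenPerturbation A B G K q r) (k : ℤ) :
    HasSum (fun j : ℕ => (r * (1 + q) / (1 - q)) ^ j * K k) (K k / (1 - r * (1 + q) / (1 - q))) :=
  HasSum.congr_of_eq
    ((hasSum_geometric_of_lt_one h.contraction_nonneg h.contraction_lt_one).mul_right (K k))
    (fun _ => rfl) (by rw [div_eq_mul_inv, mul_comm])

lemma norm_perturbed_le (h : IsGreenPerturbation A B G K q r) (n k : ℤ) :
    ‖perturbedKernel G (fun m => B m - A m) n k‖ ≤ K k / (1 - r * (1 + q) / (1 - q)) :=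
  tsum_of_norm_bounded (h.hasSum_majorant k) fun j => h.norm_iter_le k j n

variable [CompleteSpace R]

lemma summable_kernel_mul (h : IsGreenPerturbation A B G K q r) {y : ℤ → R} {M : ℝ}
    (hy : ∀ m, ‖y m‖ ≤ M) (n : ℤ) : Summable fun m => G n (m + 1) * (B m - A m) * y m :=
  Summable.of_norm_bounded ((h.hasSum_weight n).mul_right M).summable
    fun m => h.norm_kernel_mul_le (hy m) n m

lemma summable_iter (h : IsGreenPerturbation A B G K q r) (n k : ℤ) :
    Summable fun j => perturbIter G (fun m => B m - A m) k j n :=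
  Summable.of_norm_bounded (h.hasSum_majorant k).summable fun j => h.norm_iter_le k j n

/-- Applying the operator to the Neumann series drops its first term, once the two summations are
interchanged. -/
lemma perturbed_eq (h : IsGreenPerturbation A B G K q r) (n k : ℤ) :
    perturbedKernel G (fun m => B m - A m) n k = G n k +
      ∑' m, G n (m + 1) * (B m - A m) * perturbedKernel G (fun m => B m - A m) m k := by
  have h1 := tsum_mul_tsum_comm (H := fun m => G n (m + 1) * (B m - A m))
    (y := fun j m => perturbIter G (fun m => B m - A m) k j m) (h.hasSum_weight n).summable
    (h.hasSum_majorant k).summable (h.norm_kernel_le n) (fun j m => h.norm_iter_le k j m)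
  unfold perturbedKernel
  rw [h1, (h.summable_iter n k).tsum_eq_zero_add]
  rfl

/-- Bounded solutions of the integral equation are unique. -/
lemma eq_of_solutions (h : IsGreenPerturbation A B G K q r) {g y z : ℤ → R} {M N : ℝ}
    (hy : ∀ n, y n = g n + ∑' m, G n (m + 1) * (B m - A m) * y m) (hyM : ∀ n, ‖y n‖ ≤ M)
    (hz : ∀ n, z n = g n + ∑' m, G n (m + 1) * (B m - A m) * z m) (hzN : ∀ n, ‖z n‖ ≤ N)
    (n : ℤ) : y n = z n := by
  have hb : ∀ n, ‖y n - z n‖ ≤ M + N := fun n =>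
    (norm_sub_le _ _).trans (add_le_add (hyM n) (hzN n))
  have hsum : ∀ n, Summable fun m => r * q ^ (n - (m + 1)).natAbs * ‖y m - z m‖ := fun n =>
    Summable.of_nonneg_of_le
      (fun m => mul_nonneg (mul_nonneg h.r_pos.le (pow_nonneg h.q_pos.le _)) (norm_nonneg _))
      (fun m => mul_le_mul_of_nonneg_left (hb m) (mul_nonneg h.r_pos.le (pow_nonneg h.q_pos.le _)))
      ((h.hasSum_weight n).summable.mul_right (M + N))
  -- The norm of the difference is a bounded subsolution of the scalar equation with the kernel's
  -- weights.
  have key := nonpos_of_subsolution (h := fun n m : ℤ => r * q ^ (n - (m + 1)).natAbs)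
    (fun n m => mul_nonneg h.r_pos.le (pow_nonneg h.q_pos.le _)) h.contraction_nonneg
    h.contraction_lt_one (fun n => (h.hasSum_weight n).summable)
    (fun n => (h.hasSum_weight n).tsum_eq.le) hb
    (fun n => ⟨_, (hsum n).hasSum, ?_⟩) n
  · exact sub_eq_zero.1 (norm_le_zero_iff.1 key)
  · have : y n - z n = ∑' m, G n (m + 1) * (B m - A m) * (y m - z m) := by
      simp_rw [mul_sub (G n _ * _)]
      rw [(h.summable_kernel_mul hyM n).tsum_sub (h.summable_kernel_mul hzN n)]
      conv_lhs => rw [hy n, hz n]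
      abel
    rw [this]
    exact tsum_of_norm_bounded (hsum n).hasSum fun m => h.norm_kernel_mul_le le_rfl n m

/-- In the integral equation at `n + 1`, the forward identity of `G` produces `A n` times the series
at `n` and one extra term from `m = n`, which turns `A n` into `B n`. -/
lemma perturbed_forward (h : IsGreenPerturbation A B G K q r) (n k : ℤ) :
    perturbedKernel G (fun m => B m - A m) (n + 1) k =
      B n * perturbedKernel G (fun m => B m - A m) n k + if n + 1 = k then 1 else 0 := by
  set W := perturbedKernel G (fun m => B m - A m) with hW
  have hs : Summable fun m => G n (m + 1) * (B m - A m) * W m k :=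
    h.summable_kernel_mul (fun m => h.norm_perturbed_le m k) n
  have h1 : ∑' m, G (n + 1) (m + 1) * (B m - A m) * W m k =
      A n * ∑' m, G n (m + 1) * (B m - A m) * W m k + (B n - A n) * W n k := by
    have h2 : ∀ m, G (n + 1) (m + 1) * (B m - A m) * W m k =
        A n * (G n (m + 1) * (B m - A m) * W m k) + if m = n then (B n - A n) * W n k else 0 := by
      intro m
      rw [h.green.forward]
      by_cases hm : m = n
      · subst hm; simp only [if_true]; noncomm_ring
      · rw [if_neg (by omega), if_neg hm]; noncomm_ring
    rw [tsum_congr h2, (hs.mul_left (A n)).tsum_add (hasSum_ite_eq n _).summable,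
      hs.tsum_mul_left, tsum_ite_eq]
  have hfix : ∀ n, W n k = G n k + ∑' m, G n (m + 1) * (B m - A m) * W m k :=
    fun n => h.perturbed_eq n k
  have h3 := hfix n
  rw [hfix (n + 1), h1, h.green.forward n k]
  generalize ∑' m, G n (m + 1) * (B m - A m) * W m k = S at h3 ⊢
  rw [h3]
  noncomm_ring

/-- As functions of `n`, both sides are bounded solutions of the integral equation with
inhomogeneity `G n k`. The jump at `n = k` supplies the missing `B k - A k`. -/
lemma perturbed_backward (h : IsGreenPerturbation A B G K q r) (n k : ℤ) :
    perturbedKernel G (fun m => B m - A m) n k =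
      perturbedKernel G (fun m => B m - A m) n (k + 1) * B k + if n = k then 1 else 0 := by
  set W := perturbedKernel G (fun m => B m - A m) with hW
  have hW1 : ∀ m, ‖W m (k + 1) * B k‖ ≤ K (k + 1) / (1 - r * (1 + q) / (1 - q)) * ‖B k‖ := fun m =>
    (norm_mul_le _ _).trans
      (mul_le_mul_of_nonneg_right (h.norm_perturbed_le m (k + 1)) (norm_nonneg _))
  refine h.eq_of_solutions (y := fun n => W n k)
    (z := fun n => W n (k + 1) * B k + if n = k then 1 else 0) (g := fun n => G n k)
    (M := K k / (1 - r * (1 + q) / (1 - q)))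
    (N := K (k + 1) / (1 - r * (1 + q) / (1 - q)) * ‖B k‖ + ‖(1 : R)‖)
    (fun n => h.perturbed_eq n k) (fun n => h.norm_perturbed_le n k) (fun n => ?_) (fun n => ?_) n
  · have hs : Summable fun m => G n (m + 1) * (B m - A m) * W m (k + 1) :=
      h.summable_kernel_mul (fun m => h.norm_perturbed_le m (k + 1)) n
    have h2 : ∀ m, G n (m + 1) * (B m - A m) * (W m (k + 1) * B k + if m = k then 1 else 0) =
        G n (m + 1) * (B m - A m) * W m (k + 1) * B k +
          if m = k then G n (k + 1) * (B k - A k) else 0 := by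
      intro m
      by_cases hm : m = k
      · subst hm; simp only [if_true]; noncomm_ring
      · rw [if_neg hm, if_neg hm]; noncomm_ring
    rw [tsum_congr h2, (hs.mul_right (B k)).tsum_add (hasSum_ite_eq k _).summable,
      hs.tsum_mul_right, tsum_ite_eq]
    have h3 : W n (k + 1) = G n (k + 1) + ∑' m, G n (m + 1) * (B m - A m) * W m (k + 1) :=
      h.perturbed_eq n (k + 1)
    rw [h.green.backward n k]
    generalize ∑' m, G n (m + 1) * (B m - A m) * W m (k + 1) = S at h3 ⊢
    rw [h3]
    noncomm_ring
  · refine (norm_add_le _ _).trans (add_le_add (hW1 n) ?_)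
    split_ifs
    · exact le_rfl
    · rw [norm_zero]; exact norm_nonneg _

/-- Both sides are bounded solutions of the integral equation with inhomogeneity `G n k * W k k`,
where W is the perturbed kernel. For the truncated side this is where the product rules enter. -/
lemma perturbed_proj (h : IsGreenPerturbation A B G K q r) (n k : ℤ) :
    perturbedKernel G (fun m => B m - A m) n k * perturbedKernel G (fun m => B m - A m) k k =
      if k ≤ n then perturbedKernel G (fun m => B m - A m) n k else 0 := by
  set W := perturbedKernel G (fun m => B m - A m) with hW
  set M := K k / (1 - r * (1 + q) / (1 - q))
  have hWM : ∀ m, ‖W m k‖ ≤ M := fun m => h.norm_perturbed_le m k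
  have hfix : ∀ n, W n k = G n k + ∑' m, G n (m + 1) * (B m - A m) * W m k :=
    fun n => h.perturbed_eq n k
  have hz : ∀ n, ‖if k ≤ n then W n k else 0‖ ≤ M := by
    intro n
    split_ifs
    · exact hWM n
    · rw [norm_zero]; exact (norm_nonneg _).trans (hWM n)
  refine h.eq_of_solutions (y := fun n => W n k * W k k)
    (z := fun n => if k ≤ n then W n k else 0) (g := fun n => G n k * W k k)
    (M := M * ‖W k k‖) (N := M) (fun n => ?_)
    (fun n => (norm_mul_le _ _).trans (mul_le_mul_of_nonneg_right (hWM n) (norm_nonneg _)))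
    (fun n => ?_) hz n
  · have hs := h.summable_kernel_mul hWM n
    rw [tsum_congr fun m => (mul_assoc (G n (m + 1) * (B m - A m)) (W m k) (W k k)).symm,
      hs.tsum_mul_right, ← add_mul, ← hfix n]
  · have hsk := h.summable_kernel_mul hWM k
    have hsz := h.summable_kernel_mul hz n
    -- Expanding `W k k` by its own integral equation creates products `G n k * G k (m + 1)`. For `k
    -- ≤ n` they restore the terms `m < k` lost by truncation and vanish otherwise; for `n < k` they
    -- cancel the terms `k ≤ m` and vanish otherwise.
    have h1 : G n k * W k k + ∑' m, G n (m + 1) * (B m - A m) * (if k ≤ m then W m k else 0) =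
        G n k * G k k + ∑' m, (G n k * (G k (m + 1) * (B m - A m) * W m k) +
          G n (m + 1) * (B m - A m) * (if k ≤ m then W m k else 0)) := by
      rw [(hsk.mul_left _).tsum_add hsz, hsk.tsum_mul_left, ← add_assoc, ← mul_add, ← hfix k]
    rw [h1]
    by_cases hn : k ≤ n
    · rw [if_pos hn, h.green.mul_of_le_of_le hn le_rfl]
      conv_lhs => rw [hfix n]
      congr 1
      refine tsum_congr fun m => ?_
      rw [← mul_assoc, ← mul_assoc]
      by_cases hm : k ≤ m
      · rw [if_pos hm, h.green.mul_of_le_of_lt hn (by omega)]; noncomm_ring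
      · rw [if_neg hm, h.green.mul_of_le_of_le hn (by omega)]; noncomm_ring
    · rw [if_neg hn, h.green.mul_of_lt_of_le (by omega) le_rfl, zero_add]
      refine (tsum_zero.symm).trans (tsum_congr fun m => ?_)
      rw [← mul_assoc, ← mul_assoc]
      by_cases hm : k ≤ m
      · rw [if_pos hm, h.green.mul_of_lt_of_lt (by omega) (by omega)]; noncomm_ring
      · rw [if_neg hm, h.green.mul_of_lt_of_le (by omega) (by omega)]; noncomm_ring

end IsGreenPerturbation

/-! ### Exponential decay of the perturbed kernel -/

lemma tsum_int_split {R : Type*} [NormedRing R] [CompleteSpace R] {f : ℤ → R} (hf : Summable f)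
    (k : ℤ) :
    ∑' m, f m = ∑' i : ℕ, f (i + k) + ∑' i : ℕ, f (-((i : ℤ) + 1) + k) := by
  have hf' : Summable fun m => f (m + k) := (Equiv.addRight k).summable_iff.2 hf
  rw [← (Equiv.addRight k).tsum_eq f]
  refine tsum_of_nat_of_neg_add_one (f := fun m => f (m + k))
    (hf'.comp_injective Nat.cast_injective) (hf'.comp_injective fun a b hab => ?_)
  simpa using hab

lemma summable_weight_nat {q : ℝ} (hq0 : 0 ≤ q) (hq1 : q < 1) (n : ℤ) :
    Summable fun i : ℕ => q ^ (n - (i + 1)).natAbs :=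
  (hasSum_pow_natAbs_sub hq0 hq1 n).summable.comp_injective Nat.cast_injective

lemma tsum_weight_nat_le {q : ℝ} (hq0 : 0 ≤ q) (hq1 : q < 1) (n : ℤ) :
    ∑' i : ℕ, q ^ (n - (i + 1)).natAbs ≤ (1 + q) / (1 - q) := by
  have h := hasSum_pow_natAbs_sub hq0 hq1 n
  rw [← h.tsum_eq]
  exact tsum_comp_le_tsum_of_inj h.summable (fun _ => pow_nonneg hq0 _) Nat.cast_injective

lemma summable_weight_mul {q M : ℝ} (hq0 : 0 ≤ q) (hq1 : q < 1) (r : ℝ) (hr : 0 ≤ r) {u : ℕ → ℝ}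
    (hu0 : ∀ i, 0 ≤ u i) (huM : ∀ i, u i ≤ M) (n : ℤ) :
    Summable fun i : ℕ => r * q ^ (n - (i + 1)).natAbs * u i :=
  Summable.of_nonneg_of_le
    (fun i => mul_nonneg (mul_nonneg hr (pow_nonneg hq0 _)) (hu0 i))
    (fun i => mul_le_mul_of_nonneg_left (huM i) (mul_nonneg hr (pow_nonneg hq0 _)))
    (((summable_weight_nat hq0 hq1 n).mul_left r).mul_right M)

/-- Exponential decay of bounded subsolutions of a convolution equation on `ℕ`. -/
lemma le_mul_pow_of_subsolution {q r t c M : ℝ} {s : ℕ} (hq0 : 0 < q) (hr : 0 < r)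
    (hrq : r * (1 + q) / (1 - q) < 1) (hqt : q < t) (ht : t < 1)
    (hroot : r * t ^ s * (1 - q ^ 2) = (t - q) * (1 - q * t)) {u : ℕ → ℝ} (hu0 : ∀ i, 0 ≤ u i)
    (huM : ∀ i, u i ≤ M)
    (hu : ∀ j : ℕ, u j ≤
      c * q ^ j + ∑' i : ℕ, r * q ^ (((j + s : ℕ) : ℤ) - (i + 1)).natAbs * u i)
    (hc : 0 ≤ c) (j : ℕ) : u j ≤ c * ((t - q) / (r * q ^ s)) * t ^ j := by
  have hq1 : q < 1 := hqt.trans ht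
  have ht0 : 0 < t := hq0.trans hqt
  have htq : 0 < t - q := sub_pos.2 hqt
  have hqt1 : 0 < 1 - q * t := by nlinarith
  -- With this amplitude `V * t ^ j` solves the equation exactly: the terms in `q ^ j` cancel by the
  -- choice of `V`, those in `t ^ j` by `hroot`. Then `u` minus this solution is a bounded
  -- subsolution of the homogeneous equation.
  set V := c * ((t - q) / (r * q ^ s)) with hV
  have hV0 : 0 ≤ V := by positivity
  have hsv : ∀ j : ℕ, HasSum
      (fun i : ℕ => r * q ^ (((j + s : ℕ) : ℤ) - (i + 1)).natAbs * (V * t ^ i))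
      (V * t ^ j - c * q ^ j) := by
    intro j
    have h1 := (hasSum_pow_natAbs_mul_pow hq0.le hq1 ht0.le ht hqt.ne (j + s)).mul_left (r * V)
    refine HasSum.congr_of_eq h1 (fun i => by ring) ?_
    have h2 : c * q ^ j = r * V * (q ^ (j + s) / (t - q)) := by
      rw [hV, pow_add]; field_simp
    have h3 : V * t ^ j = r * V * t ^ (j + s) * ((1 - q ^ 2) / ((t - q) * (1 - q * t))) := by
      rw [← hroot, pow_add]
      have : 1 - q ^ 2 ≠ 0 := by nlinarith
      field_simp
    rw [h2, h3]
    field_simp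
    ring
  have hsu : ∀ j : ℕ, Summable fun i : ℕ =>
      r * q ^ (((j + s : ℕ) : ℤ) - (i + 1)).natAbs * u i := fun j =>
    summable_weight_mul hq0.le hq1 r hr.le hu0 huM _
  have key := nonpos_of_subsolution
    (h := fun j i : ℕ => r * q ^ (((j + s : ℕ) : ℤ) - (i + 1)).natAbs)
    (c := r * (1 + q) / (1 - q)) (d := fun j => u j - V * t ^ j) (M := M)
    (fun n m => by positivity) (div_nonneg (by positivity) (by linarith)) hrq
    (fun n => (summable_weight_nat hq0.le hq1 _).mul_left r)
    (fun n => by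
      rw [tsum_mul_left, mul_div_assoc]
      exact mul_le_mul_of_nonneg_left (tsum_weight_nat_le hq0.le hq1 _) hr.le)
    (fun n => by
      have h1 : 0 ≤ V * t ^ n := by positivity
      linarith [huM n])
    (fun n => ⟨_, ((hsu n).hasSum.sub (hsv n)).congr_of_eq (fun i => mul_sub _ _ _) rfl, by
      linarith [hu n]⟩) j
  linarith

namespace IsGreenPerturbation

variable {R : Type*} [NormedRing R] {A B : ℤ → R} {G : ℤ → ℤ → R} {K : ℤ → ℝ} {q r : ℝ}

/-- The inhomogeneity plus the contribution of the opposite half line, estimated by the uniform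
bound of the perturbed kernel. This is the origin of the first factor of κ. -/
lemma majorant_eq (k : ℤ) (j : ℕ) :
    K k * q ^ j + r / (1 - q) * (K k / (1 - r * (1 + q) / (1 - q))) * q ^ j =
      (1 + r / ((1 - r * (1 + q) / (1 - q)) * (1 - q))) * K k * q ^ j := by
  rw [div_mul_div_comm, mul_comm (1 - q) (1 - _)]
  ring

lemma factor_nonneg (h : IsGreenPerturbation A B G K q r) :
    0 ≤ 1 + r / ((1 - r * (1 + q) / (1 - q)) * (1 - q)) := by
  have h1 : 0 < 1 - q := sub_pos.2 h.q_lt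
  have h2 : 0 < 1 - r * (1 + q) / (1 - q) := sub_pos.2 h.contraction_lt_one
  have h3 := h.r_pos
  positivity

variable [CompleteSpace R]

/-- Times before `k` are estimated crudely by `M`; their weights already carry the factor `q ^ j`.
Only times from `k` on are kept as unknowns, which leaves a convolution inequality on `ℕ`. -/
lemma norm_tsum_add_le (h : IsGreenPerturbation A B G K q r) {y : ℤ → R} {M : ℝ}
    (hy : ∀ m, ‖y m‖ ≤ M) (k : ℤ) (j : ℕ) :
    ‖∑' m, G (j + k) (m + 1) * (B m - A m) * y m‖ ≤
      r / (1 - q) * M * q ^ j +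
        ∑' i : ℕ, r * q ^ ((j : ℤ) - (i + 1)).natAbs * ‖y (i + k)‖ := by
  rw [tsum_int_split (h.summable_kernel_mul hy _) k, add_comm]
  refine (norm_add_le _ _).trans (add_le_add ?_ ?_)
  · refine tsum_of_norm_bounded (g := fun i : ℕ => r * q ^ (j + i) * M) ?_ fun i => ?_
    · refine HasSum.congr_of_eq
        ((hasSum_geometric_of_lt_one h.q_pos.le h.q_lt).mul_left (r * M * q ^ j))
        (fun i => by ring) (by rw [div_eq_mul_inv]; ring)
    · have := h.norm_kernel_mul_le (hy (-((i : ℤ) + 1) + k)) (j + k) (-((i : ℤ) + 1) + k)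
      rwa [show ((j : ℤ) + k - (-((i : ℤ) + 1) + k + 1)).natAbs = j + i by omega] at this
  · refine tsum_of_norm_bounded (summable_weight_mul h.q_pos.le h.q_lt r h.r_pos.le
      (fun i => norm_nonneg _) (fun i : ℕ => hy (i + k)) _).hasSum fun i => ?_
    have := h.norm_kernel_mul_le (le_refl ‖y (i + k)‖) (j + k) (i + k)
    rwa [show ((j : ℤ) + k - ((i : ℤ) + k + 1)) = (j : ℤ) - (i + 1) by ring] at this

lemma norm_tsum_sub_le (h : IsGreenPerturbation A B G K q r) {y : ℤ → R} {M : ℝ}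
    (hy : ∀ m, ‖y m‖ ≤ M) (k : ℤ) (j : ℕ) :
    ‖∑' m, G (-j + k) (m + 1) * (B m - A m) * y m‖ ≤
      r / (1 - q) * M * q ^ j +
        ∑' i : ℕ, r * q ^ (((j + 1 : ℕ) : ℤ) - (i + 1)).natAbs * ‖y (-((i : ℤ) + 1) + k)‖ := by
  have hM : 0 ≤ M := (norm_nonneg _).trans (hy 0)
  have hq := h.q_pos
  have hr := h.r_pos
  rw [tsum_int_split (h.summable_kernel_mul hy _) k]
  refine (norm_add_le _ _).trans (add_le_add ?_ ?_)
  · refine tsum_of_norm_bounded (g := fun i : ℕ => r * q ^ (j + i) * M) ?_ fun i => ?_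
    · refine HasSum.congr_of_eq
        ((hasSum_geometric_of_lt_one h.q_pos.le h.q_lt).mul_left (r * M * q ^ j))
        (fun i => by ring) (by rw [div_eq_mul_inv]; ring)
    · have := h.norm_kernel_mul_le (hy (i + k)) (-j + k) (i + k)
      rw [show (-(j : ℤ) + k - ((i : ℤ) + k + 1)).natAbs = j + i + 1 by omega] at this
      -- One factor `q` is given up here so that the constant agrees with that of the forward half
      -- line.
      refine this.trans ?_
      gcongr r * ?_ * M
      exact pow_le_pow_of_le_one hq.le h.q_lt.le (Nat.le_succ _)
  · refine tsum_of_norm_bounded (summable_weight_mul h.q_pos.le h.q_lt r h.r_pos.le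
      (fun i => norm_nonneg _) (fun i : ℕ => hy (-((i : ℤ) + 1) + k)) _).hasSum fun i => ?_
    have := h.norm_kernel_mul_le (le_refl ‖y (-((i : ℤ) + 1) + k)‖) (-j + k) (-((i : ℤ) + 1) + k)
    rwa [show (-(j : ℤ) + k - (-((i : ℤ) + 1) + k + 1)).natAbs =
      (((j + 1 : ℕ) : ℤ) - (i + 1)).natAbs by omega] at this

lemma norm_perturbed_add_le (h : IsGreenPerturbation A B G K q r) {l : ℝ} (hql : q < l)
    (hl : l < 1) (hroot : r * (1 - q ^ 2) = (l - q) * (1 - q * l)) (k : ℤ) (j : ℕ) :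
    ‖perturbedKernel G (fun m => B m - A m) (j + k) k‖ ≤
      (1 + r / ((1 - r * (1 + q) / (1 - q)) * (1 - q))) * K k * ((l - q) / r) * l ^ j := by
  have key := le_mul_pow_of_subsolution (s := 0) h.q_pos h.r_pos h.contraction_lt_one hql hl
    (by simpa using hroot) (u := fun j : ℕ => ‖perturbedKernel G (fun m => B m - A m) (j + k) k‖)
    (c := (1 + r / ((1 - r * (1 + q) / (1 - q)) * (1 - q))) * K k)
    (fun _ => norm_nonneg _) (fun i => h.norm_perturbed_le _ k) (fun j => ?_)
    (mul_nonneg h.factor_nonneg (h.K_pos k).le) j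
  · simpa using key
  · rw [h.perturbed_eq (j + k) k, ← majorant_eq, add_assoc]
    refine (norm_add_le _ _).trans (add_le_add ?_ ?_)
    · simpa using h.bound (j + k) k
    · exact h.norm_tsum_add_le (fun m => h.norm_perturbed_le m k) k j

/-- The decay backward in time has offset `s = 2`: one unit because the unknowns start at time `k -
1`, one because the coefficient at `m` acts through `G n (m + 1)`. The first of these also puts the
extra factor `q` into `c`. -/
lemma norm_perturbed_sub_le (h : IsGreenPerturbation A B G K q r) {t : ℝ} (hqt : q < t)
    (ht : t < 1) (hroot : r * t ^ 2 * (1 - q ^ 2) = (t - q) * (1 - q * t)) (k : ℤ) (j : ℕ) :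
    ‖perturbedKernel G (fun m => B m - A m) (-((j : ℤ) + 1) + k) k‖ ≤
      (1 + r / ((1 - r * (1 + q) / (1 - q)) * (1 - q))) * K k * ((t - q) / (r * q)) * t ^ j := by
  have hq := h.q_pos
  have hr := h.r_pos
  have key := le_mul_pow_of_subsolution (s := 2) h.q_pos h.r_pos h.contraction_lt_one hqt ht
    hroot
    (u := fun j : ℕ => ‖perturbedKernel G (fun m => B m - A m) (-((j : ℤ) + 1) + k) k‖)
    (c := (1 + r / ((1 - r * (1 + q) / (1 - q)) * (1 - q))) * K k * q)
    (fun _ => norm_nonneg _) (fun i => h.norm_perturbed_le _ k) (fun j => ?_)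
    (mul_nonneg (mul_nonneg h.factor_nonneg (h.K_pos k).le) hq.le) j
  · refine key.trans (le_of_eq ?_)
    field_simp
  · rw [h.perturbed_eq _ k, mul_assoc _ q, ← pow_succ', ← majorant_eq, add_assoc]
    refine (norm_add_le _ _).trans (add_le_add ?_ ?_)
    · have := h.bound (-((j : ℤ) + 1) + k) k
      rwa [show (-((j : ℤ) + 1) + k - k).natAbs = j + 1 by omega] at this
    · exact_mod_cast h.norm_tsum_sub_le (fun m => h.norm_perturbed_le m k) k (j + 1)

/-- The integral equation at the diagonal, with the backward decay inserted into the remaining sum.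
The resulting bound is the geometric majorant of `norm_perturbed_sub_le` continued to `j = -1`. -/
lemma norm_one_sub_perturbed_le (h : IsGreenPerturbation A B G K q r) {t : ℝ} (hqt : q < t)
    (ht : t < 1) (hroot : r * t ^ 2 * (1 - q ^ 2) = (t - q) * (1 - q * t)) (k : ℤ) :
    ‖1 - perturbedKernel G (fun m => B m - A m) k k‖ ≤
      (1 + r / ((1 - r * (1 + q) / (1 - q)) * (1 - q))) * K k * ((t - q) / (r * q * t)) := by
  have hq := h.q_pos
  have hr := h.r_pos
  have ht0 : 0 < t := hq.trans hqt
  have hqt0 : 0 < 1 - q * t := by nlinarith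
  have h1 := h.norm_tsum_sub_le (fun m => h.norm_perturbed_le m k) k 0
  have h2 := (hasSum_geometric_of_lt_one (r := q * t) (by positivity) (by linarith)).mul_left
    (r * ((1 + r / ((1 - r * (1 + q) / (1 - q)) * (1 - q))) * K k * ((t - q) / (r * q))))
  have h3 : ∑' i : ℕ, r * q ^ (((0 + 1 : ℕ) : ℤ) - (i + 1)).natAbs *
      ‖perturbedKernel G (fun m => B m - A m) (-((i : ℤ) + 1) + k) k‖ ≤
      r * ((1 + r / ((1 - r * (1 + q) / (1 - q)) * (1 - q))) * K k * ((t - q) / (r * q))) *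
        (1 - q * t)⁻¹ := by
    refine hasSum_le (fun i => ?_) (summable_weight_mul h.q_pos.le h.q_lt r h.r_pos.le
      (fun i => norm_nonneg _)
      (fun i : ℕ => h.norm_perturbed_le (-((i : ℤ) + 1) + k) k) _).hasSum h2
    rw [show (((0 + 1 : ℕ) : ℤ) - ((i : ℤ) + 1)).natAbs = i by omega, mul_pow]
    refine (mul_le_mul_of_nonneg_left (h.norm_perturbed_sub_le hqt ht hroot k i)
      (by positivity)).trans (le_of_eq (by ring))
  have h4 : 1 - perturbedKernel G (fun m => B m - A m) k k = (1 - G k k) -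
    ∑' m, G k (m + 1) * (B m - A m) * perturbedKernel G (fun m => B m - A m) m k := by
    rw [h.perturbed_eq k k, sub_add_eq_sub_sub]
  simp only [Nat.cast_zero, neg_zero, zero_add] at h1 h3
  have h5 := majorant_eq (K := K) (q := q) (r := r) k 0
  rw [h4]
  refine (norm_sub_le _ _).trans ((add_le_add (h.bound_diag k) (h1.trans
    (add_le_add le_rfl h3))).trans ?_)
  rw [pow_zero, mul_one, mul_one, mul_one] at h5
  rw [pow_zero, mul_one, ← add_assoc, h5]
  generalize (1 + r / ((1 - r * (1 + q) / (1 - q)) * (1 - q))) * K k = c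
  have h6 : (t - q) / (r * q * t) = t * (1 - q ^ 2) / (q * (1 - q * t)) := by
    rw [div_eq_div_iff (by positivity) (by positivity)]
    linear_combination (-q) * hroot
  rw [h6]
  apply le_of_eq
  obtain ⟨d, hd⟩ : ∃ d, d = 1 - q * t := ⟨_, rfl⟩
  rw [← hd] at hqt0 ⊢
  field_simp
  rw [hd]
  ring

end IsGreenPerturbation

/-! ### Dependence of the kernel on the perturbation -/

lemma hasSum_pow_natAbs_add_natAbs {l : ℝ} (hl0 : 0 ≤ l) (hl1 : l < 1) (k : ℤ) :
    HasSum (fun m : ℤ => l ^ (k - (m + 1)).natAbs * l ^ (m - k).natAbs)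
      (2 * l / (1 - l ^ 2)) := by
  have hg : HasSum (fun i : ℕ => l * (l ^ 2) ^ i) (l * (1 - l ^ 2)⁻¹) :=
    (hasSum_geometric_of_lt_one (sq_nonneg l) (by nlinarith)).mul_left l
  have h := HasSum.of_nat_of_neg_add_one
    (f := fun m : ℤ => l ^ (-(m + 1)).natAbs * l ^ m.natAbs)
    (hg.congr_of_eq (fun i => ?_) rfl) (hg.congr_of_eq (fun i => ?_) rfl)
  · have h' := ((Equiv.subRight k).hasSum_iff).2 h
    refine HasSum.congr_of_eq h' (fun m => ?_) (by rw [div_eq_mul_inv]; ring)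
    rw [Function.comp_apply, Equiv.subRight_apply]
    congr 2
    congr 1
    ring
  · rw [show (-((i : ℤ) + 1)).natAbs = i + 1 by omega, Int.natAbs_natCast]; ring
  · rw [show (-(-((i : ℤ) + 1) + 1)).natAbs = i by omega,
      show (-((i : ℤ) + 1)).natAbs = i + 1 by omega]; ring

namespace IsGreenPerturbation

variable {R : Type*} [NormedRing R] [CompleteSpace R] {A B B' : ℤ → R} {G : ℤ → ℤ → R} {K : ℤ → ℝ}
  {q r : ℝ}

/-- The resolvent identity for the Green kernels of two perturbations of the same equation. -/
lemma perturbed_eq_add_tsum (h : IsGreenPerturbation A B G K q r)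
    (h' : IsGreenPerturbation A B' G K q r) {k : ℤ}
    (hs : Summable fun m =>
      K (m + 1) * ‖(B' m - B m) * perturbedKernel G (fun m => B' m - A m) m k‖) (n : ℤ) :
    perturbedKernel G (fun m => B' m - A m) n k = perturbedKernel G (fun m => B m - A m) n k +
      ∑' m, perturbedKernel G (fun m => B m - A m) n (m + 1) *
        ((B' m - B m) * perturbedKernel G (fun m => B' m - A m) m k) := by
  set W := perturbedKernel G (fun m => B m - A m)
  set W' := perturbedKernel G (fun m => B' m - A m)
  set F : ℤ → R := fun m => (B' m - B m) * W' m k with hF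
  have hW : ∀ n k, W n k = G n k + ∑' m, G n (m + 1) * (B m - A m) * W m k := h.perturbed_eq
  have hW' : ∀ n k, W' n k = G n k + ∑' m, G n (m + 1) * (B' m - A m) * W' m k := h'.perturbed_eq
  have hb : Summable fun m => K (m + 1) / (1 - r * (1 + q) / (1 - q)) * ‖F m‖ :=
    (hs.mul_left (1 - r * (1 + q) / (1 - q))⁻¹).congr fun m => by ring
  have hWF : ∀ m n, ‖W n (m + 1) * F m‖ ≤ K (m + 1) / (1 - r * (1 + q) / (1 - q)) * ‖F m‖ :=
    fun m n => (norm_mul_le _ _).trans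
      (mul_le_mul_of_nonneg_right (h.norm_perturbed_le n (m + 1)) (norm_nonneg _))
  have hsWF : ∀ n, Summable fun m => W n (m + 1) * F m := fun n =>
    Summable.of_norm_bounded hb fun m => hWF m n
  have hsGF : ∀ n, Summable fun m => G n (m + 1) * F m := fun n =>
    Summable.of_norm_bounded hs fun m => (norm_mul_le _ _).trans <|
      mul_le_mul_of_nonneg_right ((h.bound n (m + 1)).trans
        (mul_le_of_le_one_right (h.K_pos _).le (pow_le_one₀ h.q_pos.le h.q_lt.le)))
        (norm_nonneg _)
  have hD : ∀ n, ‖∑' m, W n (m + 1) * F m‖ ≤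
      ∑' m, K (m + 1) / (1 - r * (1 + q) / (1 - q)) * ‖F m‖ := fun n =>
    tsum_of_norm_bounded hb.hasSum fun m => hWF m n
  -- Both sides solve the integral equation for `B` with inhomogeneity `G n k + ∑' m, G n (m + 1) *
  -- F m`: writing `B' - A` as `(B' - B) + (B - A)` shows it for `W'`, interchanging the sums for
  -- the right-hand side.
  refine h.eq_of_solutions (y := fun n => W' n k)
    (z := fun n => W n k + ∑' m, W n (m + 1) * F m)
    (g := fun n => G n k + ∑' m, G n (m + 1) * F m) (fun n => ?_)
    (fun n => h'.norm_perturbed_le n k) (fun n => ?_)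
    (fun n => (norm_add_le _ _).trans (add_le_add (h.norm_perturbed_le n k) (hD n))) n
  · have hsW' := h.summable_kernel_mul (fun m => h'.norm_perturbed_le m k) n
    rw [add_assoc, ← (hsGF n).tsum_add hsW', hW' n k]
    congr 1
    refine tsum_congr fun m => ?_
    change _ = G n (m + 1) * ((B' m - B m) * W' m k) + G n (m + 1) * (B m - A m) * W' m k
    noncomm_ring
  · have h1 := tsum_mul_tsum_comm (H := fun m => G n (m + 1) * (B m - A m))
      (y := fun j m => W m (j + 1) * F j) (h.hasSum_weight n).summable hb
      (h.norm_kernel_le n) hWF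
    have hsW := h.summable_kernel_mul (fun m => h.norm_perturbed_le m k) n
    have hsD := h.summable_kernel_mul hD n
    have h2 : ∀ j, ∑' m, G n (m + 1) * (B m - A m) * (W m (j + 1) * F j) =
        W n (j + 1) * F j - G n (j + 1) * F j := by
      intro j
      rw [tsum_congr fun m => (mul_assoc (G n (m + 1) * (B m - A m)) _ _).symm,
        (h.summable_kernel_mul (fun m => h.norm_perturbed_le m (j + 1)) n).tsum_mul_right,
        ← sub_mul, hW n (j + 1), add_sub_cancel_left]
    rw [tsum_congr fun m => mul_add (G n (m + 1) * (B m - A m)) _ _, hsW.tsum_add hsD, h1,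
      tsum_congr h2, (hsWF n).tsum_sub (hsGF n)]
    have h3 := hW n k
    change _ = _ + (∑' m, G n (m + 1) * (B m - A m) * W m k + _)
    generalize ∑' m, G n (m + 1) * (B m - A m) * W m k = S at h3 ⊢
    rw [h3]
    abel

lemma norm_perturbed_sub_perturbed_le (h : IsGreenPerturbation A B G K q r)
    (h' : IsGreenPerturbation A B' G K q r) {κ l δ : ℝ} (hκ : 0 ≤ κ) (hl0 : 0 ≤ l) (hl1 : l < 1)
    (hδ : 0 ≤ δ)
    (hW : ∀ n m, ‖perturbedKernel G (fun m => B m - A m) n m‖ ≤ κ * K m * l ^ (n - m).natAbs)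
    (hW' : ∀ n m, ‖perturbedKernel G (fun m => B' m - A m) n m‖ ≤ κ * K m * l ^ (n - m).natAbs)
    (hBB : ∀ m, ‖B m - B' m‖ ≤ δ / K (m + 1)) (k : ℤ) :
    ‖perturbedKernel G (fun m => B m - A m) k k - perturbedKernel G (fun m => B' m - A m) k k‖ ≤
      κ ^ 2 * δ * K k * (1 + l ^ 2) / (1 - l ^ 2) := by
  have hK := h.K_pos
  -- The weight `K (m + 1)`, needed for the left kernel in the resolvent identity, is cancelled by
  -- the bound on `B - B'`.
  have hF : ∀ m, K (m + 1) * ‖(B' m - B m) * perturbedKernel G (fun m => B' m - A m) m k‖ ≤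
      κ * δ * K k * l ^ (m - k).natAbs := by
    intro m
    have hKm := hK (m + 1)
    have hKk := hK k
    calc K (m + 1) * ‖(B' m - B m) * perturbedKernel G (fun m => B' m - A m) m k‖
        ≤ K (m + 1) * (δ / K (m + 1) * (κ * K k * l ^ (m - k).natAbs)) := by
          refine mul_le_mul_of_nonneg_left ((norm_mul_le _ _).trans ?_) hKm.le
          refine mul_le_mul ?_ (hW' m k) (norm_nonneg _) (by positivity)
          rw [norm_sub_rev]; exact hBB m
      _ = κ * δ * K k * l ^ (m - k).natAbs := by field_simp
  have hs1 : Summable fun m : ℤ => κ * δ * K k * l ^ (m - k).natAbs :=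
    (((Equiv.subRight k).summable_iff).2 (hasSum_pow_natAbs hl0 hl1).summable).mul_left _
  have hs := Summable.of_nonneg_of_le (fun m => mul_nonneg (hK (m + 1)).le (norm_nonneg _)) hF hs1
  rw [h.perturbed_eq_add_tsum h' hs k, sub_add_cancel_left, norm_neg]
  have hsum : HasSum (fun m : ℤ => κ ^ 2 * δ * K k *
      (l ^ (k - (m + 1)).natAbs * l ^ (m - k).natAbs)) (κ ^ 2 * δ * K k * (2 * l / (1 - l ^ 2))) :=
    (hasSum_pow_natAbs_add_natAbs hl0 hl1 k).mul_left _
  refine (tsum_of_norm_bounded hsum fun m => ?_).trans ?_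
  · calc _ ≤ ‖perturbedKernel G (fun m => B m - A m) k (m + 1)‖ *
          ‖(B' m - B m) * perturbedKernel G (fun m => B' m - A m) m k‖ := norm_mul_le _ _
      _ ≤ (κ * K (m + 1) * l ^ (k - (m + 1)).natAbs) *
          ‖(B' m - B m) * perturbedKernel G (fun m => B' m - A m) m k‖ :=
        mul_le_mul_of_nonneg_right (hW _ _) (norm_nonneg _)
      _ = κ * l ^ (k - (m + 1)).natAbs * (K (m + 1) *
          ‖(B' m - B m) * perturbedKernel G (fun m => B' m - A m) m k‖) := by ring
      _ ≤ κ * l ^ (k - (m + 1)).natAbs * (κ * δ * K k * l ^ (m - k).natAbs) :=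
        mul_le_mul_of_nonneg_left (hF m) (by positivity)
      _ = _ := by ring
  · have h1 : 0 < 1 - l ^ 2 := by nlinarith
    have hKk := hK k
    rw [mul_div_assoc (κ ^ 2 * δ * K k)]
    gcongr
    -- The series gives the numerator `2 * l`, which is at most `1 + l ^ 2`.
    nlinarith [sq_nonneg (1 - l)]

end IsGreenPerturbation

/-! ### Roots of the characteristic equations and the constants -/

/-- The exponents and the factor of the perturbed dichotomy in terms of the roots `l` and `t` of two
quadratic equations. -/
lemma rough_spec {a r : ℝ} (ha : 0 < a) (hr : 0 < r)
    (hra : r < (1 - Real.exp (-a)) / (1 + Real.exp (-a))) :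
    ∃ l t : ℝ, Real.exp (-a) < l ∧ l < 1 ∧ Real.exp (-a) < t ∧ t ≤ l ∧
      r * (1 - Real.exp (-a) ^ 2) = (l - Real.exp (-a)) * (1 - Real.exp (-a) * l) ∧
      r * t ^ 2 * (1 - Real.exp (-a) ^ 2) = (t - Real.exp (-a)) * (1 - Real.exp (-a) * t) ∧
      Real.exp (-roughExponent a r) = l ∧
      roughFactor a r =
        (1 + r / ((1 - r * (1 + Real.exp (-a)) / (1 - Real.exp (-a))) * (1 - Real.exp (-a)))) *
          max ((l - Real.exp (-a)) / r) ((t - Real.exp (-a)) / (r * Real.exp (-a) * t)) := by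
  set q := Real.exp (-a) with hq
  have hq0 : 0 < q := Real.exp_pos _
  have hq1 : q < 1 := Real.exp_lt_one_iff.2 (by linarith)
  have hea : Real.exp a = q⁻¹ := by rw [hq, Real.exp_neg, inv_inv]
  set c := Real.cosh a with hc
  set s := Real.sinh a with hs
  have hcq : 2 * q * c = 1 + q ^ 2 := by
    rw [hc, Real.cosh_eq, hea, ← hq]; field_simp
  have hsq : 2 * q * s = 1 - q ^ 2 := by
    rw [hs, Real.sinh_eq, hea, ← hq]; field_simp
  have hs0 : 0 < s := Real.sinh_pos_iff.2 ha
  have hcs : c ^ 2 - 1 = s ^ 2 := by have := Real.cosh_sq a; rw [← hc, ← hs] at this; linarith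
  have hcmq : c - s = q := by rw [hc, hs, Real.cosh_sub_sinh]
  have hr' : r * (1 + q) < 1 - q := (lt_div_iff₀ (by linarith)).1 hra
  -- Multiplied by `1 - q`, the smallness condition on `r` becomes this inequality, which puts the
  -- smaller root `c - S` below 1. The bound `q < c - S` will follow from `S < s`, since `c - s =
  -- q`.
  have hrs : r * s < c - 1 := by
    have : 2 * q * (r * s) < 2 * q * (c - 1) := by
      calc 2 * q * (r * s) = r * (2 * q * s) := by ring
        _ = r * (1 + q) * (1 - q) := by rw [hsq]; ring
        _ < (1 - q) * (1 - q) := mul_lt_mul_of_pos_right hr' (by linarith)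
        _ = 2 * q * (c - 1) := by rw [mul_sub (2 * q), hcq]; ring
    exact lt_of_mul_lt_mul_left this (by positivity)
  have hc1 : 1 < c := by linarith [mul_pos hr hs0]
  have hdisc : (c - 1) ^ 2 < c ^ 2 - 1 - 2 * r * s := by
    have : (c - 1) ^ 2 = c ^ 2 - 2 * c + 1 := by ring
    linarith
  set S := √(c ^ 2 - 1 - 2 * r * s) with hS
  have hS2 : S ^ 2 = c ^ 2 - 1 - 2 * r * s := Real.sq_sqrt ((sq_nonneg _).trans hdisc.le)
  have hS0 : 0 ≤ S := Real.sqrt_nonneg _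
  have hSc : c - 1 < S := Real.lt_sqrt_of_sq_lt hdisc
  have hSs : S < s := by
    have := mul_pos hr hs0
    exact lt_of_pow_lt_pow_left₀ 2 hs0.le (by rw [hS2, hcs]; linarith)
  have hrs0 : 0 < r * s := mul_pos hr hs0
  have hlq : q < c - S := by linarith
  have hl1 : c - S < 1 := by linarith
  have hN : 0 < 1 + 2 * r * s := by linarith
  -- The first quadratic has roots `c - S` and `c + S` with product `1 + 2 * r * s`; hence `t` is
  -- the reciprocal of the larger root and solves the reversed quadratic.
  have hlt : (c - S) / (1 + 2 * r * s) * (c + S) = 1 := by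
    rw [div_mul_eq_mul_div, div_eq_one_iff_eq hN.ne']; linear_combination -hS2
  set t := (c - S) / (1 + 2 * r * s) with ht
  have htN : t * (1 + 2 * r * s) = c - S := div_mul_cancel₀ _ hN.ne'
  have ht0 : 0 < t := div_pos (by linarith) hN
  have htl : t ≤ c - S := by linarith [mul_pos ht0 hrs0]
  have hqt : q < t := by
    have h1 : q * (c + S) < q * (c + s) := mul_lt_mul_of_pos_left (by linarith) hq0
    have h2 : q * (c + s) = 1 := by linear_combination (hcq + hsq) / 2
    have h3 : q * (c + S) < t * (c + S) := by rw [hlt]; linarith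
    exact lt_of_mul_lt_mul_right h3 (by linarith)
  have hroot1 : r * (1 - q ^ 2) = (c - S - q) * (1 - q * (c - S)) := by
    have : (c - S) ^ 2 - 2 * c * (c - S) + 1 + 2 * r * s = 0 := by linear_combination hS2
    linear_combination q * this - r * hsq + (c - S) * hcq
  have hroot2 : r * t ^ 2 * (1 - q ^ 2) = (t - q) * (1 - q * t) := by
    have : (1 + 2 * r * s) * t ^ 2 - 2 * c * t + 1 = 0 := by
      have : t * (c - S) + t * (c + S) = 2 * c * t := by ring
      rw [hlt] at this
      linear_combination this + t * htN
    linear_combination q * this - r * t ^ 2 * hsq + t * hcq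
  have hE : Real.exp (-roughExponent a r) = c - S := by
    rw [roughExponent, neg_neg, Real.exp_log (by linarith)]
  have hB : Real.exp (-roughBeta a r) = t := by
    rw [roughBeta, neg_add, Real.exp_add, hE, Real.exp_neg, Real.exp_log hN, ht, div_eq_mul_inv]
  have hql : 0 < 1 - q * (c - S) := by linarith [mul_lt_mul_of_pos_left hl1 hq0]
  have hqt1 : 0 < 1 - q * t := by linarith [mul_lt_mul_of_pos_left (htl.trans_lt hl1) hq0]
  refine ⟨c - S, t, hlq, hl1, hqt, htl, hroot1, hroot2, hE, ?_⟩
  unfold roughFactor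
  rw [neg_add, neg_add, Real.exp_add, Real.exp_add, hE, hB, ← hq]
  congr 2
  -- The two root equations turn D₁ and D₂ into the amplitudes found by the comparison argument.
  · have h1 : 1 - r * q / (1 - q * (c - S)) = r / (c - S - q) := by
      rw [eq_div_iff (by linarith), sub_mul, one_mul, div_mul_eq_mul_div, sub_eq_iff_eq_add,
        eq_comm, ← eq_sub_iff_add_eq', div_eq_iff hql.ne']
      linear_combination hroot1
    rw [h1, one_div_div]
  · have h1 : 1 - r * t / (1 - q * t) = r * q * t / (t - q) := by
      rw [eq_div_iff (by linarith), sub_mul, one_mul, div_mul_eq_mul_div, sub_eq_iff_eq_add,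
        eq_comm, ← eq_sub_iff_add_eq', div_eq_iff hqt1.ne']
      linear_combination hroot2
    rw [h1, one_div_div]

lemma roughExponent_pos {a r : ℝ} (ha : 0 < a) (hr : 0 < r)
    (hra : r < (1 - Real.exp (-a)) / (1 + Real.exp (-a))) : 0 < roughExponent a r := by
  obtain ⟨l, t, -, hl, -, -, -, -, hE, -⟩ := rough_spec ha hr hra
  rw [← hE, Real.exp_lt_one_iff] at hl
  linarith

lemma roughFactor_pos {a r : ℝ} (ha : 0 < a) (hr : 0 < r)
    (hra : r < (1 - Real.exp (-a)) / (1 + Real.exp (-a))) : 0 < roughFactor a r := by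
  obtain ⟨l, t, hql, -, -, -, -, -, -, hF⟩ := rough_spec ha hr hra
  have hq1 : Real.exp (-a) < 1 := Real.exp_lt_one_iff.2 (by linarith)
  have hq0 := Real.exp_pos (-a)
  have h1 : r * (1 + Real.exp (-a)) / (1 - Real.exp (-a)) < 1 := by
    rw [div_lt_one (by linarith)]
    exact (lt_div_iff₀ (by linarith)).1 hra
  have h2 : 0 < 1 - Real.exp (-a) := by linarith
  have h3 : 0 < 1 - r * (1 + Real.exp (-a)) / (1 - Real.exp (-a)) := by linarith
  rw [hF]
  refine mul_pos (by positivity) (lt_max_of_lt_left (div_pos (by linarith) hr))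

namespace IsGreenPerturbation

variable {R : Type*} [NormedRing R] [CompleteSpace R] {A B : ℤ → R} {G : ℤ → ℤ → R} {K : ℤ → ℝ}
  {a r : ℝ}

/-- The backward rate `t` is at most the forward rate `l`, so `l` serves both sides. Rewriting `t ^
j` as `t ^ (j + 1) / t` accounts for the extra `t` in the second amplitude. -/
lemma norm_perturbed_le_rough (h : IsGreenPerturbation A B G K (Real.exp (-a)) r) (n k : ℤ) :
    ‖perturbedKernel G (fun m => B m - A m) n k‖ ≤
      roughFactor a r * K k * Real.exp (-roughExponent a r) ^ (n - k).natAbs := by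
  obtain ⟨l, t, hql, hl, hqt, htl, hroot1, hroot2, hE, hF⟩ :=
    rough_spec (neg_lt_zero.1 (Real.exp_lt_one_iff.1 h.q_lt)) h.r_pos h.r_lt
  have hr := h.r_pos
  have hq := h.q_pos
  have ht0 := hq.trans hqt
  have hl0 := hq.trans hql
  have hK := h.K_pos k
  have hf := h.factor_nonneg
  rw [hE, hF]
  obtain ⟨j, rfl | rfl⟩ : ∃ j : ℕ, n = j + k ∨ n = -((j : ℤ) + 1) + k := by
    rcases le_or_gt k n with hn | hn
    · exact ⟨(n - k).toNat, Or.inl (by omega)⟩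
    · exact ⟨(k - n - 1).toNat, Or.inr (by omega)⟩
  · refine (h.norm_perturbed_add_le hql hl hroot1 k j).trans ?_
    rw [show ((j : ℤ) + k - k).natAbs = j by omega, mul_right_comm _ (K k)]
    gcongr
    exact le_max_left _ _
  · refine (h.norm_perturbed_sub_le hqt (htl.trans_lt hl) hroot2 k j).trans ?_
    rw [show (-((j : ℤ) + 1) + k - k).natAbs = j + 1 by omega]
    generalize 1 + r / ((1 - r * (1 + Real.exp (-a)) / (1 - Real.exp (-a))) *
      (1 - Real.exp (-a))) = c at hf ⊢
    calc c * K k * ((t - Real.exp (-a)) / (r * Real.exp (-a))) * t ^ j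
        = c * ((t - Real.exp (-a)) / (r * Real.exp (-a) * t)) * K k * t ^ (j + 1) := by
          rw [pow_succ]; field_simp
      _ ≤ _ := by
        have : 0 ≤ t - Real.exp (-a) := by linarith
        gcongr
        exact le_max_right _ _

lemma norm_one_sub_perturbed_le_rough (h : IsGreenPerturbation A B G K (Real.exp (-a)) r) (k : ℤ) :
    ‖1 - perturbedKernel G (fun m => B m - A m) k k‖ ≤ roughFactor a r * K k := by
  obtain ⟨l, t, hql, hl, hqt, htl, hroot1, hroot2, hE, hF⟩ :=
    rough_spec (neg_lt_zero.1 (Real.exp_lt_one_iff.1 h.q_lt)) h.r_pos h.r_lt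
  have hK := h.K_pos k
  have hf := h.factor_nonneg
  rw [hF]
  refine (h.norm_one_sub_perturbed_le hqt (htl.trans_lt hl) hroot2 k).trans ?_
  rw [mul_right_comm _ (K k)]
  gcongr
  exact le_max_right _ _

end IsGreenPerturbation

/-! ### Orbits -/

section Shift

variable {Ω : Type*} [MeasurableSpace Ω] (θ : Ω ≃ᵐ Ω)

@[simp] lemma shift_zero (ω : Ω) : shift θ 0 ω = ω := by simp [shift]

lemma shift_add (n m : ℤ) (ω : Ω) : shift θ (n + m) ω = shift θ n (shift θ m ω) := by
  simp [shift, zpow_add]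

lemma shift_one (ω : Ω) : shift θ 1 ω = θ ω := by simp [shift]

lemma shift_add_one (n : ℤ) (ω : Ω) : shift θ (n + 1) ω = θ (shift θ n ω) := by
  rw [add_comm, shift_add, shift_one]

lemma shift_apply (n : ℤ) (ω : Ω) : shift θ n (θ ω) = shift θ (n + 1) ω := by
  rw [shift_add, shift_one]

lemma shift_neg_one (ω : Ω) : shift θ (-1) ω = θ.symm ω := by
  rw [← θ.symm_apply_apply (shift θ (-1) ω), ← shift_add_one, neg_add_cancel, shift_zero]

lemma shift_neg_shift (n : ℤ) (ω : Ω) : shift θ (-n) (shift θ n ω) = ω := by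
  rw [← shift_add, neg_add_cancel, shift_zero]

lemma shift_shift_neg (n : ℤ) (ω : Ω) : shift θ n (shift θ (-n) ω) = ω := by
  rw [← shift_add, add_neg_cancel, shift_zero]

lemma measurable_shift (n : ℤ) : Measurable (shift θ n) := by
  induction n using Int.induction_on with
  | zero => exact (funext (shift_zero θ)).symm ▸ measurable_id
  | succ n ih => exact (funext (shift_add_one θ n)) ▸ θ.measurable.comp ih
  | pred n ih =>
    have : shift θ (-(n : ℤ) - 1) = θ.symm ∘ shift θ (-(n : ℤ)) := by
      funext ω
      rw [Function.comp_apply, ← shift_neg_one, ← shift_add]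
      congr 1; ring
    rw [this]
    exact θ.symm.measurable.comp ih

variable {θ}

lemma eq_of_invariant {β : Type*} {f : Ω → β} (hf : ∀ ω, f (θ ω) = f ω) (n : ℤ) (ω : Ω) :
    f (shift θ n ω) = f ω := by
  induction n using Int.induction_on with
  | zero => rw [shift_zero]
  | succ n ih => rw [shift_add_one, hf, ih]
  | pred n ih => rw [← hf, ← shift_add_one, sub_add_cancel, ih]

lemma shift_mem {Ωt : Set Ω} (h : θ ⁻¹' Ωt = Ωt) {ω : Ω} (hω : ω ∈ Ωt) (n : ℤ) :
    shift θ n ω ∈ Ωt :=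
  (eq_of_invariant (f := (· ∈ Ωt)) (fun ω => congrArg (ω ∈ ·) h) n ω).mpr hω

end Shift

section UnstableRange

variable {Ω 𝕜 X : Type*} [RCLike 𝕜] [NormedAddCommGroup X] [NormedSpace 𝕜 X]

lemma unstableProj_apply (Pis : Ω → X →L[𝕜] X) (ω : Ω) (x : X) :
    unstableProj Pis ω x = x - Pis ω x := rfl

lemma mem_unstableRange_iff {Pis : Ω → X →L[𝕜] X} {ω : Ω} (h : (Pis ω).comp (Pis ω) = Pis ω)
    {y : X} : y ∈ unstableRange Pis ω ↔ Pis ω y = 0 := by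
  constructor
  · rintro ⟨x, rfl⟩
    rw [unstableProj_apply, map_sub, sub_eq_zero]
    exact (DFunLike.congr_fun h x).symm
  · intro hy
    exact ⟨y, by rw [unstableProj_apply, hy, sub_zero]⟩

end UnstableRange

/-! ### The Green kernel of a dichotomy -/

section Kernel

variable {Ω 𝕜 X : Type*} [MeasurableSpace Ω] [RCLike 𝕜] [NormedAddCommGroup X] [NormedSpace 𝕜 X]
  {θ : Ω ≃ᵐ Ω} {Φ : ℕ → Ω → X →L[𝕜] X} {Ωt : Set Ω}

/-- `g ω i` is the Green kernel of the cocycle `Φ` over the orbit of `ω`, from time `0` to `i`. -/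
structure IsGreenKernel (θ : Ω ≃ᵐ Ω) (Φ : ℕ → Ω → X →L[𝕜] X) (Ωt : Set Ω)
    (g : Ω → ℤ → X →L[𝕜] X) : Prop where
  invariant : θ ⁻¹' Ωt = Ωt
  forward : ∀ ω ∈ Ωt, ∀ i, g ω (i + 1) = Φ 1 (shift θ i ω) * g ω i + if i + 1 = 0 then 1 else 0
  backward : ∀ ω ∈ Ωt, ∀ i, g ω i = g (θ ω) (i - 1) * Φ 1 ω + if i = 0 then 1 else 0
  proj : ∀ ω ∈ Ωt, ∀ i, g ω i * g ω 0 = if 0 ≤ i then g ω i else 0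

/-- By stationarity along orbits, starting at time `m` over `ω` is starting at time 0 over `θ^m ω`;
a kernel in one time variable therefore suffices. -/
lemma IsGreenKernel.isGreen {g : Ω → ℤ → X →L[𝕜] X} (h : IsGreenKernel θ Φ Ωt g) {ω : Ω}
    (hω : ω ∈ Ωt) :
    IsGreen (fun n => Φ 1 (shift θ n ω)) (fun n m => g (shift θ m ω) (n - m)) where
  forward n m := by
    have := h.forward _ (shift_mem h.invariant hω m) (n - m)
    rw [← shift_add, sub_add_cancel, sub_add_eq_add_sub] at this
    simpa only [sub_eq_zero] using this
  backward n m := by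
    have := h.backward _ (shift_mem h.invariant hω m) (n - m)
    rw [← shift_add_one, sub_sub] at this
    simpa only [sub_eq_zero] using this
  proj n m := by
    have := h.proj _ (shift_mem h.invariant hω m) (n - m)
    simpa only [sub_nonneg, sub_self] using this

/-- The inverse of the cocycle along the unstable spaces, as a continuous linear map. -/
noncomputable def backwardCLM (θ : Ω ≃ᵐ Ω) (Φ : ℕ → Ω → X →L[𝕜] X) (Pis : Ω → X →L[𝕜] X) (n : ℕ)
    (ω : Ω) : X →L[𝕜] X :=
  Classical.epsilon fun L : X →L[𝕜] X => ∀ x, L x = backward θ Φ Pis n ω x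

/-- The Green kernel of a dichotomy. -/
noncomputable def greenKernel (θ : Ω ≃ᵐ Ω) (Φ : ℕ → Ω → X →L[𝕜] X) (Pis : Ω → X →L[𝕜] X) (ω : Ω) :
    ℤ → X →L[𝕜] X
  | Int.ofNat n => Φ n ω * Pis ω
  | Int.negSucc n => -backwardCLM θ Φ Pis (n + 1) ω

variable [MeasurableSpace X]

lemma IsMeasurableLinearCocycle.succ (hΦ : IsMeasurableLinearCocycle θ Φ) (n : ℕ) (ω : Ω) :
    Φ (n + 1) ω = Φ 1 (shift θ n ω) * Φ n ω := hΦ.add n 1 ω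

lemma IsMeasurableLinearCocycle.succ' (hΦ : IsMeasurableLinearCocycle θ Φ) (n : ℕ) (ω : Ω) :
    Φ (n + 1) ω = Φ n (θ ω) * Φ 1 ω := by
  rw [add_comm, hΦ.add 1 n ω, Nat.cast_one, shift_one]; rfl

namespace IsTemperedDichotomy

variable {P : Measure Ω} {Pis : Ω → X →L[𝕜] X} {α K : Ω → ℝ}

lemma comm_apply (h : IsTemperedDichotomy P θ Φ Ωt Pis α K) {ω : Ω} (hω : ω ∈ Ωt) (n : ℕ) (x : X) :
    Pis (shift θ n ω) (Φ n ω x) = Φ n ω (Pis ω x) :=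
  DFunLike.congr_fun (h.comm ω hω n) x

lemma proj_apply (h : IsTemperedDichotomy P θ Φ Ωt Pis α K) {ω : Ω} (hω : ω ∈ Ωt) (x : X) :
    Pis ω (Pis ω x) = Pis ω x :=
  DFunLike.congr_fun (h.proj ω hω) x

lemma mem_range_iff (h : IsTemperedDichotomy P θ Φ Ωt Pis α K) {ω : Ω} (hω : ω ∈ Ωt) {y : X} :
    y ∈ unstableRange Pis ω ↔ Pis ω y = 0 :=
  mem_unstableRange_iff (h.proj ω hω)

lemma bijOn_neg (h : IsTemperedDichotomy P θ Φ Ωt Pis α K) {ω : Ω} (hω : ω ∈ Ωt) (n : ℕ) :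
    Set.BijOn (Φ n (shift θ (-(n : ℤ)) ω)) (unstableRange Pis (shift θ (-(n : ℤ)) ω))
      (unstableRange Pis ω) := by
  have := h.iso _ (shift_mem h.invariant hω (-(n : ℤ))) n
  rwa [shift_shift_neg] at this

lemma backward_mem (h : IsTemperedDichotomy P θ Φ Ωt Pis α K) {ω : Ω} (hω : ω ∈ Ωt) (n : ℕ)
    (x : X) : Pis (shift θ (-(n : ℤ)) ω) (backward θ Φ Pis n ω x) = 0 :=
  (h.mem_range_iff (shift_mem h.invariant hω _)).1
    (Function.invFunOn_mem ((h.bijOn_neg hω n).surjOn ⟨x, rfl⟩))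

lemma map_backward (h : IsTemperedDichotomy P θ Φ Ωt Pis α K) {ω : Ω} (hω : ω ∈ Ωt) (n : ℕ)
    (x : X) : Φ n (shift θ (-(n : ℤ)) ω) (backward θ Φ Pis n ω x) = x - Pis ω x :=
  Function.invFunOn_eq ((h.bijOn_neg hω n).surjOn ⟨x, rfl⟩)

lemma backward_eq (h : IsTemperedDichotomy P θ Φ Ωt Pis α K) {ω : Ω} (hω : ω ∈ Ωt) {n : ℕ}
    {x y : X} (hy : Pis (shift θ (-(n : ℤ)) ω) y = 0)
    (hxy : Φ n (shift θ (-(n : ℤ)) ω) y = x - Pis ω x) : backward θ Φ Pis n ω x = y := by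
  have hω' := shift_mem h.invariant hω (-(n : ℤ))
  exact (h.bijOn_neg hω n).injOn ((h.mem_range_iff hω').2 (h.backward_mem hω n x))
    ((h.mem_range_iff hω').2 hy) ((h.map_backward hω n x).trans hxy.symm)

/-- Uniqueness of preimages in the unstable space makes the backward map linear and `bound_u` makes
it continuous, so on `Ωt` the choice in `backwardCLM` is a genuine one. -/
lemma backwardCLM_apply (h : IsTemperedDichotomy P θ Φ Ωt Pis α K) {ω : Ω} (hω : ω ∈ Ωt) (n : ℕ)
    (x : X) : backwardCLM θ Φ Pis n ω x = backward θ Φ Pis n ω x := by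
  let L : X →ₗ[𝕜] X :=
    { toFun := backward θ Φ Pis n ω
      map_add' := fun x y => h.backward_eq hω
        (by rw [map_add, h.backward_mem hω, h.backward_mem hω, add_zero])
        (by rw [map_add, h.map_backward hω, h.map_backward hω, map_add]; abel)
      map_smul' := fun c x => h.backward_eq hω
        (by rw [map_smul, h.backward_mem hω, smul_zero])
        (by rw [map_smul, h.map_backward hω, map_smul, smul_sub, RingHom.id_apply]) }
  exact Classical.epsilon_spec (p := fun L : X →L[𝕜] X => ∀ x, L x = backward θ Φ Pis n ω x)
    ⟨L.mkContinuous _ (h.bound_u ω hω n), fun _ => rfl⟩ x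

lemma norm_backwardCLM_le (h : IsTemperedDichotomy P θ Φ Ωt Pis α K) {ω : Ω} (hω : ω ∈ Ωt)
    (n : ℕ) : ‖backwardCLM θ Φ Pis n ω‖ ≤ K ω * Real.exp (-α ω * n) := by
  refine ContinuousLinearMap.opNorm_le_bound _
    (mul_nonneg (h.tempered.1.2 ω).le (Real.exp_pos _).le) fun x => ?_
  rw [h.backwardCLM_apply hω]
  exact h.bound_u ω hω n x

lemma backwardCLM_zero (h : IsTemperedDichotomy P θ Φ Ωt Pis α K)
    (hΦ : IsMeasurableLinearCocycle θ Φ) {ω : Ω} (hω : ω ∈ Ωt) :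
    backwardCLM θ Φ Pis 0 ω = 1 - Pis ω := by
  ext x
  rw [h.backwardCLM_apply hω]
  refine h.backward_eq hω ?_ ?_
  · rw [Nat.cast_zero, neg_zero, shift_zero]
    change Pis ω (x - Pis ω x) = 0
    rw [map_sub, h.proj_apply hω, sub_self]
  · rw [hΦ.zero]; rfl

lemma backwardCLM_forward (h : IsTemperedDichotomy P θ Φ Ωt Pis α K)
    (hΦ : IsMeasurableLinearCocycle θ Φ) {ω : Ω} (hω : ω ∈ Ωt) (n : ℕ) :
    backwardCLM θ Φ Pis n ω =
      Φ 1 (shift θ (-((n : ℤ) + 1)) ω) * backwardCLM θ Φ Pis (n + 1) ω := by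
  have hω' := shift_mem h.invariant hω (-((n : ℤ) + 1))
  have hsh : shift θ 1 (shift θ (-((n : ℤ) + 1)) ω) = shift θ (-(n : ℤ)) ω := by
    rw [← shift_add]; congr 1; ring
  ext x
  rw [mul_apply_eq_comp, h.backwardCLM_apply hω, h.backwardCLM_apply hω]
  have h1 := h.backward_mem hω (n + 1) x
  have h2 := h.map_backward hω (n + 1) x
  rw [Nat.cast_succ] at h1 h2
  refine h.backward_eq hω ?_ ?_
  · have := h.comm_apply hω' 1 (backward θ Φ Pis (n + 1) ω x)
    rw [Nat.cast_one, hsh, h1, map_zero] at this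
    exact this
  · rw [hΦ.succ', ← shift_one, hsh] at h2
    exact h2

lemma backwardCLM_backward (h : IsTemperedDichotomy P θ Φ Ωt Pis α K)
    (hΦ : IsMeasurableLinearCocycle θ Φ) {ω : Ω} (hω : ω ∈ Ωt) (n : ℕ) :
    backwardCLM θ Φ Pis n ω = backwardCLM θ Φ Pis (n + 1) (θ ω) * Φ 1 ω := by
  have hω' : θ ω ∈ Ωt := by rw [← shift_one]; exact shift_mem h.invariant hω 1
  have hsh : shift θ (-((n + 1 : ℕ) : ℤ)) (θ ω) = shift θ (-(n : ℤ)) ω := by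
    rw [shift_apply]; congr 1; push_cast; ring
  ext x
  rw [mul_apply_eq_comp, h.backwardCLM_apply hω, h.backwardCLM_apply hω']
  refine (h.backward_eq hω' ?_ ?_).symm
  · rw [hsh, h.backward_mem hω]
  · rw [hsh, hΦ.succ, shift_shift_neg, mul_apply_eq_comp, h.map_backward hω, map_sub,
      ← h.comm_apply hω 1, Nat.cast_one, shift_one]

lemma backwardCLM_mul_proj (h : IsTemperedDichotomy P θ Φ Ωt Pis α K) {ω : Ω} (hω : ω ∈ Ωt)
    (n : ℕ) : backwardCLM θ Φ Pis n ω * Pis ω = 0 := by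
  ext x
  rw [mul_apply_eq_comp, h.backwardCLM_apply hω]
  refine h.backward_eq hω ?_ ?_
  · simp
  · rw [h.proj_apply hω, sub_self]; simp

/-- Away from time 0 the identities are the cocycle property; the jump of size 1 there is Π^s + Π^u
= Id. -/
lemma isGreenKernel (h : IsTemperedDichotomy P θ Φ Ωt Pis α K)
    (hΦ : IsMeasurableLinearCocycle θ Φ) : IsGreenKernel θ Φ Ωt (greenKernel θ Φ Pis) where
  invariant := h.invariant
  forward ω hω i := by
    rcases i with n | _ | n
    · rw [if_neg (by simp only [Int.ofNat_eq_natCast]; omega), add_zero]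
      change Φ (n + 1) ω * Pis ω = Φ 1 (shift θ n ω) * (Φ n ω * Pis ω)
      rw [hΦ.succ, mul_assoc]
    · have := h.backwardCLM_forward hΦ hω 0
      rw [h.backwardCLM_zero hΦ hω] at this
      change Φ 0 ω * Pis ω = Φ 1 (shift θ (-1) ω) * -backwardCLM θ Φ Pis (0 + 1) ω + 1
      rw [mul_neg, ← sub_eq_neg_add]
      simp only [Nat.cast_zero, zero_add] at this
      rw [zero_add, ← this, hΦ.zero, sub_sub_cancel]
      rfl
    · have := h.backwardCLM_forward hΦ hω (n + 1)
      rw [if_neg (by omega), add_zero]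
      change -backwardCLM θ Φ Pis (n + 1) ω = Φ 1 (shift θ (-((n + 1 : ℕ) + 1 : ℤ)) ω) *
        -backwardCLM θ Φ Pis (n + 1 + 1) ω
      rw [mul_neg, ← this]
  backward ω hω i := by
    rcases i with (_ | n) | n
    · have := h.backwardCLM_backward hΦ hω 0
      rw [h.backwardCLM_zero hΦ hω] at this
      change Φ 0 ω * Pis ω = -backwardCLM θ Φ Pis (0 + 1) (θ ω) * Φ 1 ω + 1
      rw [neg_mul, ← this, hΦ.zero, neg_sub, sub_add_cancel]
      rfl
    · rw [if_neg (by simp only [Int.ofNat_eq_natCast]; omega), add_zero]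
      rw [show Int.ofNat (n + 1) - 1 = Int.ofNat n by simp]
      change Φ (n + 1) ω * Pis ω = Φ n (θ ω) * Pis (θ ω) * Φ 1 ω
      have := h.comm ω hω 1
      rw [Nat.cast_one, shift_one] at this
      rw [hΦ.succ', mul_assoc, mul_assoc]
      exact congrArg (Φ n (θ ω) * ·) this.symm
    · have := h.backwardCLM_backward hΦ hω (n + 1)
      rw [if_neg (by omega), add_zero]
      change -backwardCLM θ Φ Pis (n + 1) ω = -backwardCLM θ Φ Pis (n + 1 + 1) (θ ω) * Φ 1 ω
      rw [neg_mul, ← this]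
  proj ω hω i := by
    have h0 : greenKernel θ Φ Pis ω 0 = Pis ω := by
      change Φ 0 ω * Pis ω = Pis ω
      rw [hΦ.zero]; rfl
    rw [h0]
    rcases i with n | n
    · rw [if_pos (show 0 ≤ Int.ofNat n from Int.natCast_nonneg n)]
      change Φ n ω * Pis ω * Pis ω = Φ n ω * Pis ω
      rw [mul_assoc]
      exact congrArg (Φ n ω * ·) (h.proj ω hω)
    · rw [if_neg (by omega)]
      change -backwardCLM θ Φ Pis (n + 1) ω * Pis ω = 0
      rw [neg_mul, h.backwardCLM_mul_proj hω, neg_zero]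

lemma norm_greenKernel_le (h : IsTemperedDichotomy P θ Φ Ωt Pis α K) {ω : Ω} (hω : ω ∈ Ωt)
    (i : ℤ) : ‖greenKernel θ Φ Pis ω i‖ ≤ K ω * Real.exp (-α ω) ^ i.natAbs := by
  rw [← Real.exp_nat_mul, mul_comm (_ : ℝ) (-α ω)]
  rcases i with n | n
  · exact h.bound_s ω hω n
  · change ‖-backwardCLM θ Φ Pis (n + 1) ω‖ ≤ _
    rw [norm_neg]
    exact h.norm_backwardCLM_le hω (n + 1)

lemma norm_one_sub_greenKernel_le (h : IsTemperedDichotomy P θ Φ Ωt Pis α K)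
    (hΦ : IsMeasurableLinearCocycle θ Φ) {ω : Ω} (hω : ω ∈ Ωt) :
    ‖1 - greenKernel θ Φ Pis ω 0‖ ≤ K ω := by
  have h1 := h.norm_backwardCLM_le hω 0
  rw [h.backwardCLM_zero hΦ hω, Nat.cast_zero, mul_zero, Real.exp_zero, mul_one] at h1
  change ‖1 - Φ 0 ω * Pis ω‖ ≤ K ω
  rw [hΦ.zero]
  exact h1

end IsTemperedDichotomy

end Kernel

/-! ### From a Green kernel back to a dichotomy -/

section KernelInverse

variable {Ω 𝕜 X : Type*} [MeasurableSpace Ω] [RCLike 𝕜] [NormedAddCommGroup X] [NormedSpace 𝕜 X]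
  {θ : Ω ≃ᵐ Ω} {Φ : ℕ → Ω → X →L[𝕜] X} {Ωt : Set Ω} {g : Ω → ℤ → X →L[𝕜] X}

/-- The backward part of a Green kernel, completed by the complementary projection at time `0`. -/
def kernelInverse {Ω 𝕜 X : Type*} [RCLike 𝕜] [NormedAddCommGroup X] [NormedSpace 𝕜 X]
    (g : Ω → ℤ → X →L[𝕜] X) : ℕ → Ω → X →L[𝕜] X
  | 0, ω => 1 - g ω 0
  | n + 1, ω => -g ω (-((n : ℤ) + 1))

lemma backward_eq_of_bijOn {Pis : Ω → X →L[𝕜] X} {n : ℕ} {ω : Ω}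
    (hb : Set.BijOn (Φ n (shift θ (-(n : ℤ)) ω)) (unstableRange Pis (shift θ (-(n : ℤ)) ω))
      (unstableRange Pis ω)) {x y : X} (hy : y ∈ unstableRange Pis (shift θ (-(n : ℤ)) ω))
    (hxy : Φ n (shift θ (-(n : ℤ)) ω) y = unstableProj Pis ω x) : backward θ Φ Pis n ω x = y :=
  hb.injOn (Function.invFunOn_mem (hb.surjOn ⟨x, rfl⟩)) hy
    ((Function.invFunOn_eq (hb.surjOn ⟨x, rfl⟩)).trans hxy.symm)

namespace IsGreenKernel

lemma inverse_forward (h : IsGreenKernel θ Φ Ωt g) {ω : Ω} (hω : ω ∈ Ωt) (n : ℕ) :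
    kernelInverse g n ω = Φ 1 (shift θ (-((n : ℤ) + 1)) ω) * kernelInverse g (n + 1) ω := by
  have := h.forward ω hω (-((n : ℤ) + 1))
  rw [neg_add, neg_add_cancel_right, ← neg_add] at this
  rcases n with _ | n
  · simp only [kernelInverse, Nat.cast_zero, zero_add, neg_zero, if_true] at this ⊢
    rw [this]; noncomm_ring
  · rw [if_neg (by omega), add_zero] at this
    simp only [kernelInverse, Nat.cast_succ] at this ⊢
    rw [this]; noncomm_ring

lemma inverse_backward (h : IsGreenKernel θ Φ Ωt g) {ω : Ω} (hω : ω ∈ Ωt) (n : ℕ) :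
    kernelInverse g n ω = kernelInverse g (n + 1) (θ ω) * Φ 1 ω := by
  have := h.backward ω hω (-(n : ℤ))
  rw [← neg_add'] at this
  rcases n with _ | n
  · simp only [kernelInverse, Nat.cast_zero, zero_add, neg_zero, if_true] at this ⊢
    rw [this]; noncomm_ring
  · rw [if_neg (by omega), add_zero] at this
    simp only [kernelInverse, Nat.cast_succ] at this ⊢
    rw [this]; noncomm_ring

lemma proj_comp (h : IsGreenKernel θ Φ Ωt g) {ω : Ω} (hω : ω ∈ Ωt) :
    (g ω 0).comp (g ω 0) = g ω 0 :=
  (h.proj ω hω 0).trans (if_pos le_rfl)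

lemma inverse_mul_proj (h : IsGreenKernel θ Φ Ωt g) {ω : Ω} (hω : ω ∈ Ωt) (n : ℕ) :
    kernelInverse g n ω * g ω 0 = 0 := by
  rcases n with _ | n
  · have := h.proj ω hω 0
    rw [if_pos le_rfl] at this
    rw [kernelInverse, sub_mul, one_mul, this, sub_self]
  · have := h.proj ω hω (-((n : ℤ) + 1))
    rw [if_neg (by omega)] at this
    rw [kernelInverse, neg_mul, this, neg_zero]

variable [MeasurableSpace X]

lemma inverse_mul (h : IsGreenKernel θ Φ Ωt g) (hΦ : IsMeasurableLinearCocycle θ Φ) {ω : Ω}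
    (hω : ω ∈ Ωt) (n : ℕ) : kernelInverse g n (shift θ n ω) * Φ n ω = 1 - g ω 0 := by
  induction n with
  | zero =>
    rw [hΦ.zero, Nat.cast_zero, shift_zero]
    rfl
  | succ n ih =>
    rw [hΦ.succ, Nat.cast_succ, shift_add_one, ← mul_assoc,
      ← h.inverse_backward (shift_mem h.invariant hω n), ih]

lemma mul_inverse (h : IsGreenKernel θ Φ Ωt g) (hΦ : IsMeasurableLinearCocycle θ Φ) {ω : Ω}
    (hω : ω ∈ Ωt) (n : ℕ) :
    Φ n (shift θ (-(n : ℤ)) ω) * kernelInverse g n ω = 1 - g ω 0 := by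
  induction n with
  | zero =>
    rw [hΦ.zero]
    rfl
  | succ n ih =>
    have hsh : θ (shift θ (-((n : ℤ) + 1)) ω) = shift θ (-(n : ℤ)) ω := by
      rw [← shift_add_one]; congr 1; ring
    rw [hΦ.succ', Nat.cast_succ, mul_assoc, ← h.inverse_forward hω, hsh, ih]

lemma mul_proj (h : IsGreenKernel θ Φ Ωt g) (hΦ : IsMeasurableLinearCocycle θ Φ) {ω : Ω}
    (hω : ω ∈ Ωt) (n : ℕ) : Φ n ω * g ω 0 = g ω n := by
  induction n with
  | zero => rw [hΦ.zero]; rfl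
  | succ n ih =>
    have := h.forward ω hω n
    rw [if_neg (by omega), add_zero] at this
    rw [hΦ.succ, mul_assoc, ih, Nat.cast_succ, this]

/-- For one step, the forward and backward identities compute the same value `g ω 1` in two ways. -/
lemma proj_mul (h : IsGreenKernel θ Φ Ωt g) (hΦ : IsMeasurableLinearCocycle θ Φ) {ω : Ω}
    (hω : ω ∈ Ωt) (n : ℕ) : g (shift θ n ω) 0 * Φ n ω = Φ n ω * g ω 0 := by
  induction n with
  | zero => rw [hΦ.zero, Nat.cast_zero, shift_zero]; rfl
  | succ n ih =>
    have hω' := shift_mem h.invariant hω n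
    have h1 := h.forward _ hω' 0
    have h2 := h.backward _ hω' 1
    rw [if_neg (by omega), add_zero, zero_add, shift_zero] at h1
    rw [if_neg (by omega), add_zero, sub_self, h1] at h2
    rw [hΦ.succ, Nat.cast_succ, shift_add_one, ← mul_assoc, ← h2, mul_assoc, ih, mul_assoc]

/-- With L the inverse, Φ L = 1 - P and L P = 0 give L Φ L = L, while L Φ = 1 - P' gives L Φ L = L -
P' L. Here P and P' are the projections at `ω` and `θ^{-n} ω`. -/
lemma proj_mul_inverse (h : IsGreenKernel θ Φ Ωt g) (hΦ : IsMeasurableLinearCocycle θ Φ) {ω : Ω}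
    (hω : ω ∈ Ωt) (n : ℕ) : g (shift θ (-(n : ℤ)) ω) 0 * kernelInverse g n ω = 0 := by
  have h1 := h.inverse_mul hΦ (shift_mem h.invariant hω (-(n : ℤ))) n
  rw [shift_shift_neg] at h1
  have h2 := congrArg (· * kernelInverse g n ω) h1
  simp only [mul_assoc] at h2
  rw [h.mul_inverse hΦ hω, mul_sub, h.inverse_mul_proj hω, mul_one, sub_zero, sub_mul, one_mul] at h2
  exact sub_eq_self.1 h2.symm

lemma bijOn (h : IsGreenKernel θ Φ Ωt g) (hΦ : IsMeasurableLinearCocycle θ Φ) {ω : Ω}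
    (hω : ω ∈ Ωt) (n : ℕ) :
    Set.BijOn (Φ n ω) (unstableRange (fun ω => g ω 0) ω)
      (unstableRange (fun ω => g ω 0) (shift θ n ω)) := by
  have hP : ∀ ω ∈ Ωt, (g ω 0).comp (g ω 0) = g ω 0 := fun ω hω => h.proj_comp hω
  have hω' := shift_mem h.invariant hω n
  have hinv : ∀ y ∈ unstableRange (fun ω => g ω 0) ω,
      kernelInverse g n (shift θ n ω) (Φ n ω y) = y := by
    intro y hy
    have := DFunLike.congr_fun (h.inverse_mul hΦ hω n) y
    change _ = y - g ω 0 y at this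
    rwa [(mem_unstableRange_iff (hP ω hω)).1 hy, sub_zero] at this
  refine ⟨fun y hy => ?_, fun y hy z hz hyz => ?_, fun z hz => ?_⟩
  · refine (mem_unstableRange_iff (hP _ hω')).2 ?_
    have := DFunLike.congr_fun (h.proj_mul hΦ hω n) y
    change g (shift θ n ω) 0 (Φ n ω y) = Φ n ω (g ω 0 y) at this
    rw [this, (mem_unstableRange_iff (hP ω hω)).1 hy, map_zero]
  · rw [← hinv y hy, ← hinv z hz, hyz]
  · refine ⟨kernelInverse g n (shift θ n ω) z, (mem_unstableRange_iff (hP ω hω)).2 ?_, ?_⟩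
    · have := DFunLike.congr_fun (h.proj_mul_inverse hΦ hω' n) z
      rwa [shift_neg_shift] at this
    · have := DFunLike.congr_fun (h.mul_inverse hΦ hω' n) z
      rw [shift_neg_shift] at this
      change Φ n ω (kernelInverse g n (shift θ n ω) z) = z - g (shift θ n ω) 0 z at this
      rwa [(mem_unstableRange_iff (hP _ hω')).1 hz, sub_zero] at this

lemma backward_eq (h : IsGreenKernel θ Φ Ωt g) (hΦ : IsMeasurableLinearCocycle θ Φ) {ω : Ω}
    (hω : ω ∈ Ωt) (n : ℕ) (x : X) :
    _root_.backward θ Φ (fun ω => g ω 0) n ω x = kernelInverse g n ω x := by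
  have hω' := shift_mem h.invariant hω (-(n : ℤ))
  have hb := h.bijOn hΦ hω' n
  rw [shift_shift_neg] at hb
  refine backward_eq_of_bijOn hb ((mem_unstableRange_iff ?_).2 ?_) ?_
  · exact h.proj_comp hω'
  · exact DFunLike.congr_fun (h.proj_mul_inverse hΦ hω n) x
  · exact DFunLike.congr_fun (h.mul_inverse hΦ hω n) x

/-- A bounded measurable Green kernel defines a tempered dichotomy. -/
lemma isTemperedDichotomy [BorelSpace X] [SecondCountableTopology X]
    (h : IsGreenKernel θ Φ Ωt g) (hΦ : IsMeasurableLinearCocycle θ Φ) {P : Measure Ω}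
    {α K : Ω → ℝ} (hfull : ∀ᵐ ω ∂P, ω ∈ Ωt) (hα : IsInvariantPosRV θ α) (hK : IsTempered P θ K)
    (hmeas : ∀ i x, Measurable fun ω : Ωt => g ω i x)
    (hbound : ∀ ω ∈ Ωt, ∀ i, ‖g ω i‖ ≤ K ω * Real.exp (-α ω) ^ i.natAbs)
    (hbound' : ∀ ω ∈ Ωt, ‖1 - g ω 0‖ ≤ K ω) :
    IsTemperedDichotomy P θ Φ Ωt (fun ω => g ω 0) α K where
  invariant := h.invariant
  full := hfull
  measurable x := hmeas 0 x
  proj ω hω := h.proj_comp hω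
  comm ω hω n := h.proj_mul hΦ hω n
  iso ω hω n := h.bijOn hΦ hω n
  measurable_u n x := by
    have : (fun ω : Ωt => _root_.backward θ Φ (fun ω => g ω 0) n ω x) =
        fun ω : Ωt => kernelInverse g n ω x := funext fun ω => h.backward_eq hΦ ω.2 n x
    rw [this]
    rcases n with _ | n
    · exact measurable_const.sub (hmeas 0 x)
    · exact (hmeas _ x).neg
  exponent := hα
  tempered := hK
  bound_s ω hω n := by
    have h1 := h.mul_proj hΦ hω n
    have h2 := hbound ω hω n
    rw [← Real.exp_nat_mul, mul_comm (_ : ℝ) (-α ω), Int.natAbs_natCast, ← h1] at h2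
    exact h2
  bound_u ω hω n x := by
    rw [h.backward_eq hΦ hω]
    refine ContinuousLinearMap.le_of_opNorm_le _ ?_ x
    rcases n with _ | n
    · simpa [kernelInverse] using hbound' ω hω
    · have h2 := hbound ω hω (-((n : ℤ) + 1))
      rw [show (-((n : ℤ) + 1)).natAbs = n + 1 by omega, ← Real.exp_nat_mul,
        mul_comm (_ : ℝ) (-α ω)] at h2
      rw [kernelInverse, norm_neg]
      exact h2

end IsGreenKernel

end KernelInverse

/-! ### Tempered bounds and uniqueness of the projections -/

section Tempered

lemma tendsto_mul_exp_of_tendsto_log_div {k : ℕ → ℝ} (hk : ∀ n, 0 < k n)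
    (h : Tendsto (fun n : ℕ => Real.log (k n) / n) atTop (𝓝 0)) {a : ℝ} (ha : 0 < a) :
    Tendsto (fun n : ℕ => k n * Real.exp (-a * n)) atTop (𝓝 0) := by
  have hlim : Tendsto (fun n : ℕ => Real.exp (-(a / 2)) ^ n) atTop (𝓝 0) :=
    tendsto_pow_atTop_nhds_zero_of_lt_one (Real.exp_pos _).le
      (Real.exp_lt_one_iff.2 (by linarith))
  refine squeeze_zero' (Eventually.of_forall fun n => (mul_pos (hk n) (Real.exp_pos _)).le) ?_ hlim
  -- Eventually `k n` is below `exp (a / 2 * n)`, so half of the decay rate survives.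
  filter_upwards [h.eventually (gt_mem_nhds (half_pos ha)), eventually_gt_atTop 0] with n hn hn0
  have hn0' : (0 : ℝ) < n := Nat.cast_pos.2 hn0
  rw [div_lt_iff₀ hn0'] at hn
  rw [← Real.exp_log (hk n), ← Real.exp_add, ← Real.exp_nat_mul]
  exact Real.exp_le_exp.2 (by linarith)

variable {Ω : Type*} [MeasurableSpace Ω] {θ : Ω ≃ᵐ Ω} {K : Ω → ℝ} {ω : Ω}

lemma IsTemperedAt.tendsto_nat (h : IsTemperedAt θ K ω) (hK : ∀ ω, 0 < K ω) {a : ℝ} (ha : 0 < a) :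
    Tendsto (fun n : ℕ => K (shift θ n ω) * Real.exp (-a * n)) atTop (𝓝 0) := by
  refine tendsto_mul_exp_of_tendsto_log_div (fun n => hK _) ?_ ha
  simpa [Function.comp_def] using h.1.comp tendsto_natCast_atTop_atTop

lemma IsTemperedAt.tendsto_neg_nat (h : IsTemperedAt θ K ω) (hK : ∀ ω, 0 < K ω) {a : ℝ}
    (ha : 0 < a) :
    Tendsto (fun n : ℕ => K (shift θ (-(n : ℤ)) ω) * Real.exp (-a * n)) atTop (𝓝 0) := by
  refine tendsto_mul_exp_of_tendsto_log_div (fun n => hK _) ?_ ha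
  have h1 : Tendsto (fun n : ℕ => -(n : ℤ)) atTop atBot :=
    tendsto_neg_atTop_atBot.comp tendsto_natCast_atTop_atTop
  simpa [Function.comp_def, div_neg] using (h.2.comp h1).neg

lemma IsTemperedAt.invariant_mul {f : Ω → ℝ} (hf : ∀ ω, f (θ ω) = f ω) (hf0 : ∀ ω, 0 < f ω)
    (hK : ∀ ω, 0 < K ω) (h : IsTemperedAt θ K ω) : IsTemperedAt θ (fun ω => f ω * K ω) ω := by
  have heq : (fun n : ℤ => Real.log (f (shift θ n ω) * K (shift θ n ω)) / (n : ℝ)) =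
      fun n : ℤ => Real.log (f ω) / (n : ℝ) + Real.log (K (shift θ n ω)) / (n : ℝ) := by
    funext n
    rw [eq_of_invariant hf, Real.log_mul (hf0 _).ne' (hK _).ne', add_div]
  unfold IsTemperedAt
  rw [heq]
  constructor
  · simpa using (tendsto_const_nhds.div_atTop (tendsto_intCast_atTop_atTop (R := ℝ))).add h.1
  · simpa using (tendsto_const_nhds.div_atBot (tendsto_intCast_atBot_iff.2 tendsto_id)).add h.2

end Tempered

section Uniqueness

lemma eq_zero_of_norm_le {X : Type*} [NormedAddCommGroup X] {x : X} {u : ℕ → ℝ} {a c : ℝ} (ha : 0 < a)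
    (hu : Tendsto (fun n : ℕ => u n * Real.exp (-a * n)) atTop (𝓝 0))
    (hx : ∀ n : ℕ, ‖x‖ ≤ u n * Real.exp (-a * n) * (c * Real.exp (-a * n))) : x = 0 := by
  have h1 : Tendsto (fun n : ℕ => Real.exp (-a * n)) atTop (𝓝 0) := by
    have h2 := tendsto_pow_atTop_nhds_zero_of_lt_one (Real.exp_pos (-a)).le
      (Real.exp_lt_one_iff.2 (by linarith))
    refine h2.congr fun n => ?_
    rw [← Real.exp_nat_mul, mul_comm]
  have h3 := hu.mul (h1.const_mul c)
  rw [zero_mul] at h3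
  exact norm_le_zero_iff.1 (ge_of_tendsto' h3 hx)

variable {Ω 𝕜 X : Type*} [MeasurableSpace Ω] [RCLike 𝕜] [NormedAddCommGroup X] [NormedSpace 𝕜 X]
  [MeasurableSpace X] {θ : Ω ≃ᵐ Ω} {Φ : ℕ → Ω → X →L[𝕜] X} {Ωt : Set Ω} {P : Measure Ω}
  {Pis Pis' : Ω → X →L[𝕜] X} {α K : Ω → ℝ}

/-- The projections of a dichotomy are unique wherever the bound is tempered. -/
lemma IsTemperedDichotomy.proj_unique (h : IsTemperedDichotomy P θ Φ Ωt Pis α K)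
    (h' : IsTemperedDichotomy P θ Φ Ωt Pis' α K) {ω : Ω} (hω : ω ∈ Ωt)
    (hK : IsTemperedAt θ K ω) : Pis ω = Pis' ω := by
  have hα := h.exponent.1.2 ω
  have hK0 := h.tempered.1.2
  ext x
  -- The vector Π^u Π'^s x is carried forward `n` steps at the stable rate of the second dichotomy,
  -- then back at the unstable rate of the first. The bound at `θ^n ω` is tempered and loses against
  -- the decay.
  have h1 : Pis' ω x - Pis ω (Pis' ω x) = 0 := by
    refine eq_zero_of_norm_le (c := K ω * ‖x‖) hα (hK.tendsto_nat hK0 hα) fun n => ?_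
    have hω' := shift_mem h.invariant hω n
    have hb := h.bound_u _ hω' n (Φ n ω (Pis' ω x))
    rw [h.backward_eq (y := Pis' ω x - Pis ω (Pis' ω x)) hω' ?_ ?_,
      eq_of_invariant h.exponent.2] at hb
    · refine hb.trans (mul_le_mul_of_nonneg_left ?_ (mul_pos (hK0 _) (Real.exp_pos _)).le)
      exact (ContinuousLinearMap.le_of_opNorm_le _ (h'.bound_s ω hω n) x).trans_eq (by ring)
    · rw [shift_neg_shift, map_sub, h.proj_apply hω, sub_self]
    · rw [shift_neg_shift, map_sub, h.comm_apply hω]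
  -- Symmetrically, Π^s Π'^u x is carried back `n` steps and then forward. The two facts say that Π'
  -- = Π Π' and Π = Π Π'.
  have h2 : Pis ω (x - Pis' ω x) = 0 := by
    refine eq_zero_of_norm_le (c := K ω * ‖x‖) hα (hK.tendsto_neg_nat hK0 hα) fun n => ?_
    have hω' := shift_mem h.invariant hω (-(n : ℤ))
    have hc := h.comm_apply hω' n (backward θ Φ Pis' n ω x)
    rw [shift_shift_neg, h'.map_backward hω] at hc
    rw [hc]
    have hb := ContinuousLinearMap.le_of_opNorm_le _ (h.bound_s _ hω' n)
      (backward θ Φ Pis' n ω x)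
    rw [eq_of_invariant h.exponent.2] at hb
    refine hb.trans (mul_le_mul_of_nonneg_left ?_ (mul_pos (hK0 _) (Real.exp_pos _)).le)
    exact (h'.bound_u ω hω n x).trans_eq (by ring)
  rw [map_sub, sub_eq_zero] at h2
  rw [h2]
  exact (sub_eq_zero.1 h1).symm

end Uniqueness

/-! ### The perturbed kernel over the base space and its measurability -/

section RoughKernel

variable {Ω 𝕜 X : Type*} [MeasurableSpace Ω] [RCLike 𝕜] [NormedAddCommGroup X] [NormedSpace 𝕜 X]

/-- The Green kernel of the cocycle `Ψ`, seen as a perturbation of the cocycle `Φ` with Green kernel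
`g`. -/
noncomputable def roughKernel (θ : Ω ≃ᵐ Ω) (Φ Ψ : ℕ → Ω → X →L[𝕜] X) (g : Ω → ℤ → X →L[𝕜] X)
    (ω : Ω) (i : ℤ) : X →L[𝕜] X :=
  perturbedKernel (fun n m => g (shift θ m ω) (n - m))
    (fun m => Ψ 1 (shift θ m ω) - Φ 1 (shift θ m ω)) i 0

variable {θ : Ω ≃ᵐ Ω} {Φ Ψ : ℕ → Ω → X →L[𝕜] X} {Ωt : Set Ω} {g : Ω → ℤ → X →L[𝕜] X}

lemma roughKernel_shift (k : ℤ) (ω : Ω) (i : ℤ) :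
    roughKernel θ Φ Ψ g (shift θ k ω) i =
      perturbedKernel (fun n m => g (shift θ m ω) (n - m))
        (fun m => Ψ 1 (shift θ m ω) - Φ 1 (shift θ m ω)) (i + k) k := by
  have h := perturbedKernel_shift (G := fun n m => g (shift θ m ω) (n - m))
    (G' := fun n m => g (shift θ m (shift θ k ω)) (n - m))
    (C := fun m => Ψ 1 (shift θ m ω) - Φ 1 (shift θ m ω))
    (C' := fun m => Ψ 1 (shift θ m (shift θ k ω)) - Φ 1 (shift θ m (shift θ k ω))) (k := k)
    (fun n m => by rw [← shift_add, add_sub_add_right_eq_sub])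
    (fun m => by rw [← shift_add]) i 0
  rwa [zero_add] at h

lemma isGreenKernel_roughKernel [CompleteSpace X] (hΩt : θ ⁻¹' Ωt = Ωt) {K : Ω → ℤ → ℝ}
    {q r : Ω → ℝ}
    (h : ∀ ω ∈ Ωt, IsGreenPerturbation (fun n => Φ 1 (shift θ n ω)) (fun n => Ψ 1 (shift θ n ω))
      (fun n m => g (shift θ m ω) (n - m)) (K ω) (q ω) (r ω)) :
    IsGreenKernel θ Ψ Ωt (roughKernel θ Φ Ψ g) where
  invariant := hΩt
  forward ω hω i := (h ω hω).perturbed_forward i 0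
  backward ω hω i := by
    rw [← shift_one, roughKernel_shift, sub_add_cancel]
    have := (h ω hω).perturbed_backward i 0
    rwa [zero_add, shift_zero] at this
  proj ω hω i := (h ω hω).perturbed_proj i 0

section Measurability

variable [MeasurableSpace X] [BorelSpace X] [SecondCountableTopology X]

/-- The map is continuous in the vector and measurable in the parameter, hence jointly measurable
because `X` is second countable. -/
lemma measurable_clm_apply {S : Type*} [MeasurableSpace S] {T : S → X →L[𝕜] X} {f : S → X}
    (hT : ∀ x, Measurable fun s => T s x) (hf : Measurable f) : Measurable fun s => T s (f s) :=
  (measurable_uncurry_of_continuous_of_measurable (u := fun x s => T s x)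
    (fun s => (T s).continuous) hT).comp (hf.prodMk measurable_id)

lemma measurable_shift_subtype (hΩt : θ ⁻¹' Ωt = Ωt) (n : ℤ) :
    Measurable fun ω : Ωt => (⟨shift θ n ω, shift_mem hΩt ω.2 n⟩ : Ωt) :=
  ((measurable_shift θ n).comp measurable_subtype_coe).subtype_mk

lemma IsTemperedDichotomy.measurable_greenKernel {P : Measure Ω} {Pis : Ω → X →L[𝕜] X}
    {α K : Ω → ℝ} (h : IsTemperedDichotomy P θ Φ Ωt Pis α K)
    (hΦ : IsMeasurableLinearCocycle θ Φ) (i : ℤ) (x : X) :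
    Measurable fun ω : Ωt => greenKernel θ Φ Pis ω i x := by
  rcases i with n | n
  · exact measurable_clm_apply (T := fun ω : Ωt => Φ n ω) (f := fun ω : Ωt => Pis ω x)
      (fun x => (hΦ.measurable n x).comp measurable_subtype_coe) (h.measurable x)
  · have : (fun ω : Ωt => greenKernel θ Φ Pis ω (Int.negSucc n) x) =
        fun ω : Ωt => -backward θ Φ Pis (n + 1) ω x :=
      funext fun ω => congrArg Neg.neg (h.backwardCLM_apply ω.2 (n + 1) x)
    rw [this]
    exact (h.measurable_u (n + 1) x).neg

variable [CompleteSpace X]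

lemma measurable_perturbIter (hΩt : θ ⁻¹' Ωt = Ωt) (hΦ : IsMeasurableLinearCocycle θ Φ)
    (hΨ : IsMeasurableLinearCocycle θ Ψ) (hg : ∀ i x, Measurable fun ω : Ωt => g ω i x)
    {K : Ω → ℤ → ℝ} {q r : Ω → ℝ}
    (h : ∀ ω ∈ Ωt, IsGreenPerturbation (fun n => Φ 1 (shift θ n ω)) (fun n => Ψ 1 (shift θ n ω))
      (fun n m => g (shift θ m ω) (n - m)) (K ω) (q ω) (r ω)) (j : ℕ) (n : ℤ) (x : X) :
    Measurable fun ω : Ωt => perturbIter (fun n m => g (shift θ m ω) (n - m))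
      (fun m => Ψ 1 (shift θ m ω) - Φ 1 (shift θ m ω)) 0 j n x := by
  have hshift : ∀ (m i : ℤ) (x : X), Measurable fun ω : Ωt => g (shift θ m ω) i x := fun m i x =>
    (hg i x).comp (measurable_shift_subtype hΩt m)
  induction j generalizing n with
  | zero => exact hshift 0 (n - 0) x
  | succ j ih =>
    -- Only strong measurability is available, so the norm-convergent operator series is evaluated
    -- at `x` before measurability is checked term by term.
    have heq : ∀ ω : Ωt, perturbIter (fun n m => g (shift θ m ω) (n - m))
        (fun m => Ψ 1 (shift θ m ω) - Φ 1 (shift θ m ω)) 0 (j + 1) n x =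
        ∑' m, g (shift θ (m + 1) ω) (n - (m + 1)) ((Ψ 1 (shift θ m ω) - Φ 1 (shift θ m ω))
          (perturbIter (fun n m => g (shift θ m ω) (n - m))
            (fun m => Ψ 1 (shift θ m ω) - Φ 1 (shift θ m ω)) 0 j m x)) := fun ω =>
      (ContinuousLinearMap.apply 𝕜 X x).map_tsum
        ((h ω ω.2).summable_kernel_mul (fun m => (h ω ω.2).norm_iter_le 0 j m) n)
    simp_rw [heq]
    refine Measurable.tsum fun m => measurable_clm_apply (hshift _ _)
      (measurable_clm_apply (fun y => ?_) (ih m))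
    have hm : Measurable fun ω : Ωt => shift θ m ω :=
      (measurable_shift θ m).comp measurable_subtype_coe
    exact ((hΨ.measurable 1 y).comp hm).sub ((hΦ.measurable 1 y).comp hm)

lemma measurable_roughKernel (hΩt : θ ⁻¹' Ωt = Ωt) (hΦ : IsMeasurableLinearCocycle θ Φ)
    (hΨ : IsMeasurableLinearCocycle θ Ψ) (hg : ∀ i x, Measurable fun ω : Ωt => g ω i x)
    {K : Ω → ℤ → ℝ} {q r : Ω → ℝ}
    (h : ∀ ω ∈ Ωt, IsGreenPerturbation (fun n => Φ 1 (shift θ n ω)) (fun n => Ψ 1 (shift θ n ω))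
      (fun n m => g (shift θ m ω) (n - m)) (K ω) (q ω) (r ω)) (i : ℤ) (x : X) :
    Measurable fun ω : Ωt => roughKernel θ Φ Ψ g ω i x := by
  have heq : ∀ ω : Ωt, roughKernel θ Φ Ψ g ω i x =
      ∑' j, perturbIter (fun n m => g (shift θ m ω) (n - m))
        (fun m => Ψ 1 (shift θ m ω) - Φ 1 (shift θ m ω)) 0 j i x := fun ω =>
    (ContinuousLinearMap.apply 𝕜 X x).map_tsum ((h ω ω.2).summable_iter i 0)
  simp_rw [heq]
  exact Measurable.tsum fun j => measurable_perturbIter hΩt hΦ hΨ hg h j i x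

end Measurability

end RoughKernel

/-! ### Roughness and the Hölder estimate -/

section Roughness

variable {Ω 𝕜 X : Type*} [MeasurableSpace Ω] [RCLike 𝕜] [NormedAddCommGroup X] [NormedSpace 𝕜 X]
  [MeasurableSpace X] {P : Measure Ω} {θ : Ω ≃ᵐ Ω} {Φ Ψ : ℕ → Ω → X →L[𝕜] X} {Ωt : Set Ω}
  {Pis : Ω → X →L[𝕜] X} {α K ρ : Ω → ℝ}

lemma isInvariantPosRV_roughExponent (hα : IsInvariantPosRV θ α) (hρ : IsInvariantPosRV θ ρ)
    (hρα : ∀ ω, ρ ω < (1 - Real.exp (-α ω)) / (1 + Real.exp (-α ω))) :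
    IsInvariantPosRV θ fun ω => roughExponent (α ω) (ρ ω) := by
  have h1 := hα.1.1
  have h2 := hρ.1.1
  refine ⟨⟨?_, fun ω => roughExponent_pos (hα.1.2 ω) (hρ.1.2 ω) (hρα ω)⟩, fun ω => ?_⟩
  · unfold roughExponent
    fun_prop
  · simp only [hα.2 ω, hρ.2 ω]

lemma isInvariantPosRV_roughFactor (hα : IsInvariantPosRV θ α) (hρ : IsInvariantPosRV θ ρ)
    (hρα : ∀ ω, ρ ω < (1 - Real.exp (-α ω)) / (1 + Real.exp (-α ω))) :
    IsInvariantPosRV θ fun ω => roughFactor (α ω) (ρ ω) := by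
  have h1 := hα.1.1
  have h2 := hρ.1.1
  refine ⟨⟨?_, fun ω => roughFactor_pos (hα.1.2 ω) (hρ.1.2 ω) (hρα ω)⟩, fun ω => ?_⟩
  · unfold roughFactor roughBeta roughExponent
    fun_prop
  · simp only [hα.2 ω, hρ.2 ω]

lemma IsTempered.invariant_mul {f : Ω → ℝ} (hf : IsInvariantPosRV θ f) (hK : IsTempered P θ K) :
    IsTempered P θ fun ω => f ω * K ω :=
  ⟨⟨hf.1.1.mul hK.1.1, fun ω => mul_pos (hf.1.2 ω) (hK.1.2 ω)⟩,
    hK.2.mono fun _ h => h.invariant_mul hf.2 hf.1.2 hK.1.2⟩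

lemma IsTemperedDichotomy.isGreenPerturbation (h : IsTemperedDichotomy P θ Φ Ωt Pis α K)
    (hΦ : IsMeasurableLinearCocycle θ Φ) (hρ : IsInvariantPosRV θ ρ)
    (hρα : ∀ ω, ρ ω < (1 - Real.exp (-α ω)) / (1 + Real.exp (-α ω)))
    (hΨ : ∀ ω ∈ Ωt, ‖Φ 1 ω - Ψ 1 ω‖ ≤ ρ ω / K (θ ω)) {ω : Ω} (hω : ω ∈ Ωt) :
    IsGreenPerturbation (fun n => Φ 1 (shift θ n ω)) (fun n => Ψ 1 (shift θ n ω))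
      (fun n m => greenKernel θ Φ Pis (shift θ m ω) (n - m)) (fun m => K (shift θ m ω))
      (Real.exp (-α ω)) (ρ ω) where
  green := (h.isGreenKernel hΦ).isGreen hω
  K_pos _ := h.tempered.1.2 _
  q_pos := Real.exp_pos _
  q_lt := Real.exp_lt_one_iff.2 (neg_lt_zero.2 (h.exponent.1.2 ω))
  r_pos := hρ.1.2 ω
  r_lt := hρα ω
  bound n m := by
    have := h.norm_greenKernel_le (shift_mem h.invariant hω m) (n - m)
    rwa [eq_of_invariant h.exponent.2] at this
  bound_diag n := by
    have := h.norm_one_sub_greenKernel_le hΦ (shift_mem h.invariant hω n)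
    rwa [sub_self]
  close m := by
    have := hΨ _ (shift_mem h.invariant hω m)
    rwa [norm_sub_rev, eq_of_invariant hρ.2, ← shift_add_one] at this

/-- Roughness of tempered dichotomies. -/
lemma IsTemperedDichotomy.roughness [CompleteSpace X] [BorelSpace X] [SecondCountableTopology X]
    (h : IsTemperedDichotomy P θ Φ Ωt Pis α K)
    (hΦ : IsMeasurableLinearCocycle θ Φ) (hΨ : IsMeasurableLinearCocycle θ Ψ)
    (hρ : IsInvariantPosRV θ ρ)
    (hρα : ∀ ω, ρ ω < (1 - Real.exp (-α ω)) / (1 + Real.exp (-α ω)))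
    (hΦΨ : ∀ ω ∈ Ωt, ‖Φ 1 ω - Ψ 1 ω‖ ≤ ρ ω / K (θ ω)) :
    IsTemperedDichotomy P θ Ψ Ωt (fun ω => roughKernel θ Φ Ψ (greenKernel θ Φ Pis) ω 0)
      (fun ω => roughExponent (α ω) (ρ ω)) (fun ω => roughFactor (α ω) (ρ ω) * K ω) := by
  have hp : ∀ ω ∈ Ωt, _ := fun ω hω => h.isGreenPerturbation hΦ hρ hρα hΦΨ hω
  refine (isGreenKernel_roughKernel h.invariant hp).isTemperedDichotomy hΨ h.full
    (isInvariantPosRV_roughExponent h.exponent hρ hρα)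
    (h.tempered.invariant_mul (isInvariantPosRV_roughFactor h.exponent hρ hρα))
    (fun i x => measurable_roughKernel h.invariant hΦ hΨ (h.measurable_greenKernel hΦ) hp i x)
    (fun ω hω i => ?_) (fun ω hω => ?_)
  · have := (hp ω hω).norm_perturbed_le_rough i 0
    rwa [shift_zero, sub_zero] at this
  · have := (hp ω hω).norm_one_sub_perturbed_le_rough 0
    rwa [shift_zero] at this

/-- For a fixed pair of parameters `δ` stands for υ |ξ₁ - ξ₂|^σ, which is invariant and hence
constant along the orbit. -/
lemma norm_roughKernel_sub_le [CompleteSpace X] {Ψ' : ℕ → Ω → X →L[𝕜] X}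
    (h : IsTemperedDichotomy P θ Φ Ωt Pis α K)
    (hΦ : IsMeasurableLinearCocycle θ Φ) (hρ : IsInvariantPosRV θ ρ)
    (hρα : ∀ ω, ρ ω < (1 - Real.exp (-α ω)) / (1 + Real.exp (-α ω)))
    (hΦΨ : ∀ ω ∈ Ωt, ‖Φ 1 ω - Ψ 1 ω‖ ≤ ρ ω / K (θ ω))
    (hΦΨ' : ∀ ω ∈ Ωt, ‖Φ 1 ω - Ψ' 1 ω‖ ≤ ρ ω / K (θ ω)) {δ : Ω → ℝ} (hδ0 : ∀ ω, 0 ≤ δ ω)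
    (hδ : ∀ ω, δ (θ ω) = δ ω) (hΨΨ' : ∀ ω ∈ Ωt, ‖Ψ 1 ω - Ψ' 1 ω‖ ≤ δ ω / K (θ ω))
    {ω : Ω} (hω : ω ∈ Ωt) :
    ‖roughKernel θ Φ Ψ (greenKernel θ Φ Pis) ω 0 - roughKernel θ Φ Ψ' (greenKernel θ Φ Pis) ω 0‖ ≤
      roughFactor (α ω) (ρ ω) ^ 2 * δ ω * K ω *
        (1 + Real.exp (-2 * roughExponent (α ω) (ρ ω))) /
          (1 - Real.exp (-2 * roughExponent (α ω) (ρ ω))) := by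
  have hp := h.isGreenPerturbation hΦ hρ hρα hΦΨ hω
  have hp' := h.isGreenPerturbation hΦ hρ hρα hΦΨ' hω
  have hα := h.exponent.1.2 ω
  have key := hp.norm_perturbed_sub_perturbed_le hp'
    (roughFactor_pos hα (hρ.1.2 ω) (hρα ω)).le (Real.exp_pos _).le
    (Real.exp_lt_one_iff.2 (neg_lt_zero.2 (roughExponent_pos hα (hρ.1.2 ω) (hρα ω)))) (hδ0 ω)
    hp.norm_perturbed_le_rough hp'.norm_perturbed_le_rough (fun m => ?_) 0
  · rw [shift_zero, ← Real.exp_nat_mul, Nat.cast_ofNat, mul_neg, ← neg_mul] at key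
    exact key
  · have := hΨΨ' _ (shift_mem h.invariant hω m)
    rwa [eq_of_invariant hδ, ← shift_add_one] at this

end Roughness

theorem mainTheorem4 {Ω 𝕜 X Ξ : Type*} [MeasurableSpace Ω] (P : Measure Ω)
    (θ : Ω ≃ᵐ Ω) (hθ : MeasurePreserving θ P P)
    [RCLike 𝕜] [NormedAddCommGroup X] [NormedSpace 𝕜 X] [CompleteSpace X]
    [TopologicalSpace.SeparableSpace X] [MeasurableSpace X] [BorelSpace X]
    [NormedAddCommGroup Ξ] [NormedSpace ℝ Ξ]
    (Φ : ℕ → Ω → X →L[𝕜] X) (hΦ : IsMeasurableLinearCocycle θ Φ)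
    (Ψ : Ξ → ℕ → Ω → X →L[𝕜] X) (hΨ : ∀ ξ, IsMeasurableLinearCocycle θ (Ψ ξ))
    (Ωt : Set Ω) (Pis : Ω → X →L[𝕜] X) (α K : Ω → ℝ)
    (hA1 : IsTemperedDichotomy P θ Φ Ωt Pis α K)
    (ρ : Ω → ℝ) (hρ : IsInvariantPosRV θ ρ)
    (hρα : ∀ ω, ρ ω < (1 - Real.exp (-α ω)) / (1 + Real.exp (-α ω)))
    (hA2 : ∀ ω ∈ Ωt, ∀ ξ, ‖Φ 1 ω - Ψ ξ 1 ω‖ ≤ ρ ω / K (θ ω)) :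
    -- the new projections, with a common exponent and a common bound
    (∃ Pit : Ξ → Ω → X →L[𝕜] X,
      (∀ ξ, IsTemperedDichotomy P θ (Ψ ξ) Ωt (Pit ξ)
        (fun ω => roughExponent (α ω) (ρ ω)) (fun ω => roughFactor (α ω) (ρ ω) * K ω)) ∧
      -- Hölder dependence of these projections on the parameter
      (∀ (υ : Ω → ℝ) (σ : ℝ), IsInvariantPosRV θ υ → 0 < σ → σ ≤ 1 →
        (∀ ω ∈ Ωt, ∀ ξ₁ ξ₂, ‖Ψ ξ₁ 1 ω - Ψ ξ₂ 1 ω‖ ≤ υ ω * ‖ξ₁ - ξ₂‖ ^ σ / K (θ ω)) →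
        ∀ ω ∈ Ωt, HolderEstimateAt Pit (α ω) (ρ ω) (K ω) (υ ω) σ ω)) ∧
    -- for any other choice of the projections, the same estimate holds almost everywhere
    (∀ Pit : Ξ → Ω → X →L[𝕜] X,
      (∀ ξ, IsTemperedDichotomy P θ (Ψ ξ) Ωt (Pit ξ)
        (fun ω => roughExponent (α ω) (ρ ω)) (fun ω => roughFactor (α ω) (ρ ω) * K ω)) →
      ∀ (υ : Ω → ℝ) (σ : ℝ), IsInvariantPosRV θ υ → 0 < σ → σ ≤ 1 →
        (∀ ω ∈ Ωt, ∀ ξ₁ ξ₂, ‖Ψ ξ₁ 1 ω - Ψ ξ₂ 1 ω‖ ≤ υ ω * ‖ξ₁ - ξ₂‖ ^ σ / K (θ ω)) →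
        ∀ᵐ ω ∂P, HolderEstimateAt Pit (α ω) (ρ ω) (K ω) (υ ω) σ ω) := by
  have : SecondCountableTopology X := UniformSpace.secondCountable_of_separable X
  set Pit₀ : Ξ → Ω → X →L[𝕜] X := fun ξ ω => roughKernel θ Φ (Ψ ξ) (greenKernel θ Φ Pis) ω 0
  have hdich : ∀ ξ, IsTemperedDichotomy P θ (Ψ ξ) Ωt (Pit₀ ξ)
      (fun ω => roughExponent (α ω) (ρ ω)) (fun ω => roughFactor (α ω) (ρ ω) * K ω) := fun ξ =>
    hA1.roughness hΦ (hΨ ξ) hρ hρα fun ω hω => hA2 ω hω ξ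
  have hholder : ∀ (υ : Ω → ℝ) (σ : ℝ), IsInvariantPosRV θ υ →
      (∀ ω ∈ Ωt, ∀ ξ₁ ξ₂, ‖Ψ ξ₁ 1 ω - Ψ ξ₂ 1 ω‖ ≤ υ ω * ‖ξ₁ - ξ₂‖ ^ σ / K (θ ω)) →
      ∀ ω ∈ Ωt, HolderEstimateAt Pit₀ (α ω) (ρ ω) (K ω) (υ ω) σ ω := by
    intro υ σ hυ hΨυ ω hω ξ₁ ξ₂
    refine (norm_roughKernel_sub_le hA1 hΦ hρ hρα (fun ω hω => hA2 ω hω ξ₁)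
      (fun ω hω => hA2 ω hω ξ₂) (δ := fun ω => υ ω * ‖ξ₁ - ξ₂‖ ^ σ)
      (fun ω => mul_nonneg (hυ.1.2 ω).le (Real.rpow_nonneg (norm_nonneg _) _))
      (fun ω => by rw [hυ.2]) (fun ω hω => hΨυ ω hω ξ₁ ξ₂) hω).trans_eq ?_
    ring
  refine ⟨⟨Pit₀, hdich, fun υ σ hυ _ _ hΨυ => hholder υ σ hυ hΨυ⟩, ?_⟩
  intro Pit hPit υ σ hυ _ _ hΨυ
  have htemp := hA1.tempered.invariant_mul (isInvariantPosRV_roughFactor hA1.exponent hρ hρα)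
  -- The exceptional set depends only on `Ωt` and on the common bound, not on the parameters, so one
  -- null set serves all pairs even if Ξ is uncountable.
  filter_upwards [hA1.full, htemp.2] with ω hω hK ξ₁ ξ₂
  rw [(hPit ξ₁).proj_unique (hdich ξ₁) hω hK, (hPit ξ₂).proj_unique (hdich ξ₂) hω hK]
  exact hholder υ σ hυ hΨυ ω hω ξ₁ ξ₂
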